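/- Let $d,m\ge 0$ be integers and let $F$ be a probability distribution on $\mathbb{R}^d$ such that $0\le x^Ty\le 1$ for all $x,y\in\operatorname{supp}F$ (a $d$-dimensional inner product distribution), and assume that the second moment matrix $\Delta=\mathbb{E}X_1X_1^T\in\mathbb{R}^{d\times d}$, $X_1\sim F$, has full rank $d$. For each $n$ let $(A,X)=(A^{(n)},X^{(n)})\sim\operatorname{RDPG}(F,n)$, all defined on a common probability space with an arbitrary joint law across $n$: the rows $X_1,\dots,X_n\in\mathbb{R}^d$ of $X$ are i.i.d. from $F$ and, conditionally on $X$, $A\in\{0,1\}^{n\times n}$ is symmetric with zero diagonal and independent entries $A_{ij}\sim\operatorname{Bern}(X_i^TX_j)$, $1\le i<j\le n$. For $n\ge d$ let $\hat X=\operatorname{ASE}(A,d)=\hat U|\hat S|^{1/2}\in\mathbb{R}^{n\times d}$, where the diagonal matrix $\hat S\in\mathbb{R}^{d\times d}$ holds the $d$ largest-magnitude eigenvalues of $A$ and $\hat U\in\mathbb{R}^{n\times d}$ has corresponding orthonormal eigenvectors as columns (any choice of eigenvectors, for each outcome). Denote the rows of $\hat X$ by $\hat X_1,\dots,\hat X_n$.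 Let $h:(\mathbb{R}^d)^m\to\mathbb{R}$ be symmetric in its $m$ arguments and such that (i) $h(Qz_1,\dots,Qz_m)=h(z_1,\dots,z_m)$ for every orthogonal $Q\in\mathbb{R}^{d\times d}$ and all $z_1,\dots,z_m\in\mathbb{R}^d$; (ii) $h$ is twice differentiable on some open set $\mathcal S\subseteq(\mathbb{R}^d)^m$ containing $(\operatorname{supp}F)^m$, with $\sup_{z\in\mathcal S}\|\nabla^2h(z)\|<\infty$, and $\nabla^2h$ is continuous on $(\operatorname{supp}F)^m$ (which is closed). Define $$U_n=\binom nm^{-1}\sum_{1\le i_1<\dots<i_m\le n}h(X_{i_1},\dots,X_{i_m}),\qquad \hat U_n=\binom nm^{-1}\sum_{1\le i_1<\dots<i_m\le n}h(\hat X_{i_1},\dots,\hat X_{i_m}).$$ Then $\sqrt n\,(\hat U_n-U_n)\to0$ almost surely as $n\to\infty$. -/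

import Mathlib

open MeasureTheory ProbabilityTheory Filter
open scoped Topology ENNReal

noncomputable section

namespace RDPG

/-- A `d`-dimensional inner product distribution: a probability measure `F` on `ℝ^d` with
`0 ≤ xᵀy ≤ 1` for all `x, y ∈ supp F`. -/
structure IsInnerProductDistribution {d : ℕ} (F : Measure (EuclideanSpace ℝ (Fin d))) : Prop where
  isProbabilityMeasure : IsProbabilityMeasure F
  inner_mem : ∀ x ∈ F.support, ∀ y ∈ F.support, 0 ≤ inner ℝ x y ∧ inner ℝ x y ≤ 1

/-- The second moment matrix `Δ = 𝔼 X₁ X₁ᵀ` of `X₁ ∼ F`. -/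
def secondMoment {d : ℕ} (F : Measure (EuclideanSpace ℝ (Fin d))) : Matrix (Fin d) (Fin d) ℝ :=
  Matrix.of fun s t => ∫ x, x s * x t ∂F

open Classical in
/-- The conditional probability, given latent positions `x₁, …, xₙ`, that the random dot product
graph on `n` vertices equals `g`: the product over all pairs `i < j` of the `Bern(xᵢᵀxⱼ)`-probability
of the edge indicator of `{i, j}` in `g`. -/
def graphProb {n d : ℕ} (x : Fin n → EuclideanSpace ℝ (Fin d)) (g : SimpleGraph (Fin n)) : ℝ :=
  ∏ e : Fin n × Fin n with e.1 < e.2,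
    if g.Adj e.1 e.2 then inner ℝ (x e.1) (x e.2) else 1 - inner ℝ (x e.1) (x e.2)

open Classical in
/-- `(A, X) ∼ RDPG(F, n)`, for random variables `A`, `X` on a probability space `(Ω, μ)`. The rows
`X₁, …, Xₙ` are i.i.d. from `F`; given `X`, the matrix `A` is the adjacency matrix of a graph on
`n` vertices whose edges `i < j` are independent with `A_{ij} ∼ Bern(XᵢᵀXⱼ)`. The last field says
that the conditional probability of `A` being the adjacency matrix of `g` is `graphProb X g`; as
these probabilities sum to one over all `g`, it also forces `A` to be almost surely symmetric, with
entries in `{0, 1}` and zero diagonal. -/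
structure IsRDPG {Ω : Type*} [MeasurableSpace Ω] (μ : Measure Ω) {d : ℕ}
    (F : Measure (EuclideanSpace ℝ (Fin d))) (n : ℕ)
    (A : Ω → Matrix (Fin n) (Fin n) ℝ) (X : Ω → Fin n → EuclideanSpace ℝ (Fin d)) : Prop where
  measurable_X : Measurable X
  measurable_A : ∀ i j, Measurable fun ω => A ω i j
  law_X : μ.map X = Measure.pi fun _ : Fin n => F
  cond_law_A : ∀ (g : SimpleGraph (Fin n)) (B : Set (Fin n → EuclideanSpace ℝ (Fin d))),
    MeasurableSet B →
      μ {ω | X ω ∈ B ∧ A ω = g.adjMatrix ℝ} =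
        ∫⁻ x in B, ENNReal.ofReal (graphProb x g) ∂(Measure.pi fun _ : Fin n => F)

/-- `X̂` (given by its rows) is an adjacency spectral embedding `ASE(A, d) = Û Ŝ^{1/2}` of the
symmetric matrix `A`: for some orthonormal basis of eigenvectors of `A`, listed by decreasing
magnitude of the eigenvalues, `Ŝ` holds the first `d` eigenvalues and the columns of `Û` are the
corresponding eigenvectors. Any choice of eigenvectors (signs, bases of eigenspaces, order of ties)
is allowed, and `Ŝ^{1/2}` has the entries `|λ|^{1/2}`. -/
def IsASE {n d : ℕ} (A : Matrix (Fin n) (Fin n) ℝ)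
    (Xhat : Fin n → EuclideanSpace ℝ (Fin d)) : Prop :=
  ∃ (hdn : d ≤ n) (b : OrthonormalBasis (Fin n) ℝ (EuclideanSpace ℝ (Fin n))) (ev : Fin n → ℝ),
    (∀ k, Matrix.toEuclideanLin A (b k) = ev k • b k) ∧
    (∀ k l, k ≤ l → |ev l| ≤ |ev k|) ∧
    ∀ i s, Xhat i s = b (Fin.castLE hdn s) i * √|ev (Fin.castLE hdn s)|

open Classical in
/-- The U-statistic `(n choose m)⁻¹ ∑_{i₁ < ⋯ < iₘ} h(x_{i₁}, …, x_{iₘ})` with kernel `h`. -/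
def uStat {E : Type*} {m n : ℕ} (h : (Fin m → E) → ℝ) (x : Fin n → E) : ℝ :=
  ((n.choose m : ℕ) : ℝ)⁻¹ * ∑ c : Fin m → Fin n with StrictMono c, h fun k => x (c k)

/-- `h` is symmetric in its `m` arguments. -/
def IsSymmetricKernel {E : Type*} {m : ℕ} (h : (Fin m → E) → ℝ) : Prop :=
  ∀ (σ : Equiv.Perm (Fin m)) (z : Fin m → E), h (fun k => z (σ k)) = h z

/-- `h(Qz₁, …, Qzₘ) = h(z₁, …, zₘ)` for all orthogonal `d × d` matrices `Q`. -/
def IsOrthogonallyInvariant {d m : ℕ} (h : (Fin m → EuclideanSpace ℝ (Fin d)) → ℝ) : Prop :=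
  ∀ Q ∈ Matrix.orthogonalGroup (Fin d) ℝ, ∀ z : Fin m → EuclideanSpace ℝ (Fin d),
    h (fun k => Matrix.toEuclideanLin Q (z k)) = h z

/-- The product `(supp F)^m ⊆ (ℝ^d)^m`. -/
def supportPow {d : ℕ} (F : Measure (EuclideanSpace ℝ (Fin d))) (m : ℕ) :
    Set (Fin m → EuclideanSpace ℝ (Fin d)) :=
  {z | ∀ k, z k ∈ F.support}

/-- The Hessian of `h`, as the derivative of the derivative. Its operator norm is taken with respect
to the norm `max_k ‖z_k‖` on `(ℝ^d)^m`, so it is equivalent to the spectral norm of the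
`md × md` matrix of second partial derivatives. -/
def hessian {d m : ℕ} (h : (Fin m → EuclideanSpace ℝ (Fin d)) → ℝ)
    (z : Fin m → EuclideanSpace ℝ (Fin d)) :
    (Fin m → EuclideanSpace ℝ (Fin d)) →L[ℝ] (Fin m → EuclideanSpace ℝ (Fin d)) →L[ℝ] ℝ :=
  fderiv ℝ (fderiv ℝ h) z

/-- `h` is twice differentiable on an open neighbourhood `S` of `(supp F)^m` on which its Hessian is
bounded, and the Hessian is continuous on the closure of `(supp F)^m`. -/
def HasBoundedHessianNearSupport {d m : ℕ} (F : Measure (EuclideanSpace ℝ (Fin d)))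
    (h : (Fin m → EuclideanSpace ℝ (Fin d)) → ℝ) : Prop :=
  ContinuousOn (hessian h) (closure (supportPow F m)) ∧
  ∃ S : Set (Fin m → EuclideanSpace ℝ (Fin d)), IsOpen S ∧ supportPow F m ⊆ S ∧
    (∀ z ∈ S, DifferentiableAt ℝ h z ∧ DifferentiableAt ℝ (fderiv ℝ h) z) ∧
    ∃ C : ℝ, ∀ z ∈ S, ‖hessian h z‖ ≤ C

end RDPG

end

/-! Write E = A - XXᵀ. By orthogonal invariance of h, X̂ may be replaced by X̂Qᵀ for any orthogonal
Q. A Taylor expansion at the latent positions then bounds |Û - U| by (1/n)|∑ᵢ ⟨Gᵢ, Δᵢ⟩| plus a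
constant times (1/n) ∑ᵢ ‖Δᵢ‖², where Δᵢ is the aligned error of vertex i and G is n times the
gradient of the U-statistic (`abs_uStat_sub_le`). The squared errors sum to O(log n), so the
quadratic term survives multiplication by √n.

The linear term is the crux: Cauchy–Schwarz with that total error would leave √(log n) after
scaling. Instead, the eigenvector equation gives X̂Qᵀ = X + EXZ + R, with Z of size d × d and norm
O(1/n), and R of operator norm o(1) (`exists_orthogonal_embedding_expansion`). As G is a bounded
function of X alone and the edges are independent given X, the entries of GᵀEX concentrate at
O(n√log n). Hence EXZ contributes O(√log n) to the sum, and R contributes o(√n) by Cauchy–Schwarz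
(`exists_ae_eventually_alignedError_le`).

The inputs on E come from sub-Gaussian tails given X. A union bound over sign vectors yields ‖E‖ ≤
2n^(7/8), which is cruder than the order √n but suffices. Full rank of the second moment matrix
makes the Gram matrix XᵀX grow like n, which separates the d leading eigenvalues of A from the
noise. Borel–Cantelli turns every tail bound into an almost sure one, so the coupling across n plays
no role. -/

noncomputable section

namespace RDPG

/-! ### Spectral norms of matrices and near-orthogonal matrices. -/

section OperatorNorm

open Matrix
open scoped Matrix.Norms.L2Operator

variable {ι κ : Type*} [Fintype ι] [Fintype κ]

theorem l2_opNorm_transpose [DecidableEq ι] [DecidableEq κ] (A : Matrix ι κ ℝ) : ‖Aᵀ‖ = ‖A‖ := by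
  rw [← l2_opNorm_conjTranspose A, conjTranspose_eq_transpose_of_trivial]

theorem norm_toLp_sq (v : ι → ℝ) : ‖WithLp.toLp 2 v‖ ^ 2 = v ⬝ᵥ v := by
  rw [EuclideanSpace.norm_sq_eq]
  simp [dotProduct, sq]

theorem mulVec_dotProduct_mulVec_le [DecidableEq κ] (A : Matrix ι κ ℝ) (v : κ → ℝ) :
    (A *ᵥ v) ⬝ᵥ (A *ᵥ v) ≤ ‖A‖ ^ 2 * (v ⬝ᵥ v) := by
  have h := A.l2_opNorm_mulVec (WithLp.toLp 2 v)
  rw [← norm_toLp_sq, ← norm_toLp_sq, ← mul_pow]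
  exact pow_le_pow_left₀ (norm_nonneg _) h 2

theorem l2_opNorm_le_of_forall [DecidableEq κ] (A : Matrix ι κ ℝ) {C : ℝ} (hC : 0 ≤ C)
    (h : ∀ v : κ → ℝ, (A *ᵥ v) ⬝ᵥ (A *ᵥ v) ≤ C ^ 2 * (v ⬝ᵥ v)) : ‖A‖ ≤ C := by
  rw [l2_opNorm_def]
  refine ContinuousLinearMap.opNorm_le_bound _ hC fun v => ?_
  refine le_of_sq_le_sq ?_ (by positivity)
  have := h v.ofLp
  rw [← norm_toLp_sq, ← norm_toLp_sq, ← mul_pow] at this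
  exact this

theorem l2_opNorm_sq_le_sum_sq [DecidableEq κ] (A : Matrix ι κ ℝ) :
    ‖A‖ ^ 2 ≤ ∑ i, ∑ j, A i j ^ 2 := by
  have h0 : 0 ≤ ∑ i, ∑ j, A i j ^ 2 := by positivity
  rw [← Real.sqrt_le_sqrt_iff h0, Real.sqrt_sq (norm_nonneg _)]
  refine l2_opNorm_le_of_forall A (Real.sqrt_nonneg _) fun v => ?_
  rw [Real.sq_sqrt h0, Finset.sum_mul]
  simp only [dotProduct, mulVec, ← sq]
  exact Finset.sum_le_sum fun i _ => Finset.sum_mul_sq_le_sq_mul_sq _ _ _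

theorem sum_col_sq_le [DecidableEq κ] (A : Matrix ι κ ℝ) (j : κ) :
    ∑ i, A i j ^ 2 ≤ ‖A‖ ^ 2 := by
  have := mulVec_dotProduct_mulVec_le A (Pi.single j 1)
  rw [single_one_dotProduct, Pi.single_eq_same, mul_one] at this
  simpa [dotProduct, ← sq] using this

theorem sum_sq_le_card_mul [DecidableEq κ] (A : Matrix ι κ ℝ) :
    ∑ i, ∑ j, A i j ^ 2 ≤ Fintype.card κ * ‖A‖ ^ 2 := by
  rw [Finset.sum_comm]
  refine (Finset.sum_le_sum fun j _ => sum_col_sq_le A j).trans ?_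
  simp

theorem sum_row_sq_le [DecidableEq ι] [DecidableEq κ] (A : Matrix ι κ ℝ) (i : ι) :
    ∑ j, A i j ^ 2 ≤ ‖A‖ ^ 2 := by
  simpa [l2_opNorm_transpose] using sum_col_sq_le Aᵀ i

theorem l2_opNorm_orthogonal_le [DecidableEq ι] {Q : Matrix ι ι ℝ}
    (hQ : Q ∈ Matrix.orthogonalGroup ι ℝ) : ‖Q‖ ≤ 1 := by
  cases isEmpty_or_nonempty ι
  · rw [Subsingleton.elim Q 0]; simp
  · exact (CStarRing.norm_of_mem_unitary hQ).le

/-- Q is the polar factor W(WᵀW)^(-1/2); the hypothesis puts the eigenvalues l of WᵀW in (0, 2).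
Then W - Q = Q((WᵀW)^(1/2) - 1), and |√l - 1| ≤ |l - 1| because √l + 1 ≥ 1. -/
theorem exists_orthogonal_norm_sub_le [DecidableEq ι] (W : Matrix ι ι ℝ) (hW : ‖1 - Wᵀ * W‖ < 1) :
    ∃ Q ∈ Matrix.orthogonalGroup ι ℝ, ‖W - Q‖ ≤ ‖1 - Wᵀ * W‖ := by
  have hB : (Wᵀ * W).IsHermitian := by
    simpa [conjTranspose_eq_transpose_of_trivial] using isHermitian_conjTranspose_mul_self W
  set V : Matrix ι ι ℝ := hB.eigenvectorUnitary.1 with hV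
  set l := hB.eigenvalues
  have hVU : V ∈ Matrix.orthogonalGroup ι ℝ := hB.eigenvectorUnitary.2
  have hV1 : Vᵀ * V = 1 := (Matrix.mem_orthogonalGroup_iff' ι ℝ).1 hVU
  have hV2 : V * Vᵀ = 1 := (Matrix.mem_orthogonalGroup_iff ι ℝ).1 hVU
  have hVtU : Vᵀ ∈ Matrix.orthogonalGroup ι ℝ := Unitary.star_mem hVU
  have hspec : Wᵀ * W = V * diagonal l * Vᵀ := by
    have := hB.spectral_theorem
    rw [Unitary.conjStarAlgAut_apply] at this
    exact this
  have hconj (a : ι → ℝ) : ‖V * diagonal a * Vᵀ‖ = ‖a‖ := by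
    rw [CStarRing.norm_mul_mem_unitary _ hVtU, CStarRing.norm_mem_unitary_mul _ hVU,
      l2_opNorm_diagonal]
  have h1 : 1 - Wᵀ * W = V * diagonal (fun i => 1 - l i) * Vᵀ := by
    rw [hspec, ← diagonal_sub, diagonal_one, Matrix.mul_sub, Matrix.sub_mul, Matrix.mul_one, hV2]
  rw [h1, hconj] at hW ⊢
  have hli (i) : |1 - l i| < 1 := lt_of_le_of_lt (norm_le_pi_norm (fun i => 1 - l i) i) hW
  have hl (i) : 0 < l i := by have := abs_lt.1 (hli i); linarith
  have hs (i) : √(l i) * √(l i) = l i := Real.mul_self_sqrt (hl i).le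
  have hs0 (i) : 0 < √(l i) := Real.sqrt_pos.2 (hl i)
  set Q := W * (V * diagonal (fun i => (√(l i))⁻¹) * Vᵀ) with hQdef
  have hQ : Q ∈ Matrix.orthogonalGroup ι ℝ := by
    rw [Matrix.mem_orthogonalGroup_iff']
    change Qᵀ * Q = 1
    have : Qᵀ * Q = V * (diagonal (fun i => (√(l i))⁻¹) * (Vᵀ * V) * diagonal l * (Vᵀ * V) *
        diagonal (fun i => (√(l i))⁻¹)) * Vᵀ := by
      rw [hQdef, Matrix.transpose_mul, Matrix.transpose_mul, Matrix.transpose_mul,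
        Matrix.transpose_transpose, diagonal_transpose]
      calc _ = V * (diagonal (fun i => (√(l i))⁻¹)) * Vᵀ * (Wᵀ * W) *
            (V * diagonal (fun i => (√(l i))⁻¹) * Vᵀ) := by simp only [Matrix.mul_assoc]
        _ = _ := by rw [hspec]; simp only [Matrix.mul_assoc]
    rw [this, hV1, Matrix.mul_one, Matrix.mul_one, diagonal_mul_diagonal, diagonal_mul_diagonal]
    have : (fun i => (√(l i))⁻¹ * l i * (√(l i))⁻¹) = fun _ => 1 := by
      funext i
      have := (hs0 i).ne'
      field_simp
      rw [sq, hs]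
    rw [this, diagonal_one, Matrix.mul_one, hV2]
  refine ⟨Q, hQ, ?_⟩
  have h2 : W - Q = Q * (V * diagonal (fun i => √(l i) - 1) * Vᵀ) := by
    have : Q * (V * diagonal (fun i => √(l i)) * Vᵀ) = W := by
      rw [hQdef]
      calc _ = W * (V * (diagonal (fun i => (√(l i))⁻¹) * (Vᵀ * V) *
            diagonal (fun i => √(l i))) * Vᵀ) := by simp only [Matrix.mul_assoc]
        _ = _ := by
          rw [hV1, Matrix.mul_one, diagonal_mul_diagonal]
          have : (fun i => (√(l i))⁻¹ * √(l i)) = fun _ => 1 := by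
            funext i
            exact inv_mul_cancel₀ (hs0 i).ne'
          rw [this, diagonal_one, Matrix.mul_one, hV2, Matrix.mul_one]
    rw [← diagonal_sub, diagonal_one, Matrix.mul_sub, Matrix.sub_mul, Matrix.mul_one, hV2,
      Matrix.mul_sub, this, Matrix.mul_one]
  rw [h2, CStarRing.norm_mem_unitary_mul _ hQ, hconj]
  refine (pi_norm_le_iff_of_nonneg (norm_nonneg _)).2 fun i => ?_
  refine le_trans ?_ (norm_le_pi_norm (fun i => 1 - l i) i)
  have h4 : 1 - l i = -((√(l i) - 1) * (√(l i) + 1)) := by linear_combination hs i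
  rw [Real.norm_eq_abs, Real.norm_eq_abs, h4, abs_neg, abs_mul]
  have h3 : 1 ≤ |√(l i) + 1| := by
    rw [abs_of_pos (by linarith [hs0 i])]
    linarith [hs0 i]
  exact le_mul_of_one_le_right (abs_nonneg _) h3

end OperatorNorm

/-! ### Deterministic perturbation expansion of the spectral embedding. -/

section Embedding

open Matrix
open scoped Matrix.Norms.L2Operator

/-- Here Y is the embedding, D its eigenvalues and S = D⁻¹. The equation Y = (XXᵀ + E)YS splits Y as
XW + R with W = XᵀYS nearly orthogonal and R = EYS; Q replaces W at a small cost. In the application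
N = n, q is a constant, r has order √log n and ε bounds the noise. -/
theorem exists_orthogonal_embedding_expansion {ι κ : Type*} [Fintype ι] [Fintype κ] [DecidableEq ι]
    [DecidableEq κ] {X Y : Matrix ι κ ℝ} {E : Matrix ι ι ℝ} {D S : Matrix κ κ ℝ}
    (hE : Eᵀ = E) (hS : Sᵀ = S) (hDS : D * S = 1) (hgram : Yᵀ * Y = D)
    (heig : (X * Xᵀ + E) * Y = Y * D) {N q ε r : ℝ} (hN : 0 < N) (hq : 1 ≤ q) (hr : 1 ≤ r)
    (hX : ‖X‖ ≤ √N) (hSn : ‖S‖ ≤ q ^ 2 / N) (hEn : ‖E‖ ≤ ε) (hEX : ‖E * X‖ ≤ N * r)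
    (hXEX : ‖Xᵀ * E * X‖ ≤ N * r) (hε : q ^ 2 * ε / N ≤ 1 / 2) (hsmall : 7 * q ^ 8 * r ^ 2 / N < 1) :
    ∃ Q ∈ Matrix.orthogonalGroup κ ℝ, ∃ Z : Matrix κ κ ℝ, ‖Z‖ ≤ 7 * q ^ 8 / N ∧
      ‖Y * Qᵀ - X - E * X * Z‖ ≤ 7 * q ^ 8 * (ε * r / N + r ^ 2 / √N) := by
  have hsN : 0 < √N := Real.sqrt_pos.2 hN
  have hsN2 : √N * √N = N := Real.mul_self_sqrt hN.le
  have hε0 : 0 ≤ ε := (norm_nonneg _).trans hEn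
  set W := Xᵀ * (Y * S) with hW
  set R := E * (Y * S) with hR
  have hYS : ‖Y * S‖ ≤ q / √N := by
    refine abs_le_of_sq_le_sq' ?_ (by positivity) |>.2
    have h1 := l2_opNorm_conjTranspose_mul_self (Y * S)
    rw [conjTranspose_eq_transpose_of_trivial, Matrix.transpose_mul, hS,
      show S * Yᵀ * (Y * S) = S * (Yᵀ * Y * S) by simp only [Matrix.mul_assoc], hgram, hDS,
      Matrix.mul_one] at h1
    rw [sq, ← h1, div_pow, sq (√N), hsN2]
    exact hSn
  have hWn : ‖W‖ ≤ q := by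
    calc ‖W‖ ≤ ‖Xᵀ‖ * ‖Y * S‖ := l2_opNorm_mul _ _
      _ ≤ √N * (q / √N) := by rw [l2_opNorm_transpose]; gcongr
      _ = q := by field_simp
  have hY : Y = X * W + R := by
    calc Y = Y * (D * S) := by rw [hDS, Matrix.mul_one]
      _ = (X * Xᵀ + E) * Y * S := by rw [heig, Matrix.mul_assoc]
      _ = _ := by rw [hW, hR, Matrix.add_mul, Matrix.add_mul]; simp only [Matrix.mul_assoc]
  -- One more substitution of Y = XW + R isolates the leading term EX(WS); what is left carries a
  -- second factor E and a factor S of order 1/N.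
  have hR2 : R = E * X * (W * S) + E * R * S := by
    conv_lhs => rw [hR, hY]
    rw [Matrix.add_mul, Matrix.mul_add]
    simp only [Matrix.mul_assoc]
  have hWS : ‖W * S‖ ≤ q ^ 3 / N := by
    calc ‖W * S‖ ≤ ‖W‖ * ‖S‖ := l2_opNorm_mul _ _
      _ ≤ q * (q ^ 2 / N) := by gcongr
      _ = _ := by ring
  have hRS : ‖E * R * S‖ ≤ q ^ 2 * ε / N * ‖R‖ := by
    calc ‖E * R * S‖ ≤ ‖E * R‖ * ‖S‖ := l2_opNorm_mul _ _
      _ ≤ (‖E‖ * ‖R‖) * ‖S‖ := by gcongr; exact l2_opNorm_mul _ _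
      _ ≤ (ε * ‖R‖) * (q ^ 2 / N) := by gcongr
      _ = _ := by ring
  -- By `hε` the term ERS has norm at most half of that of R, so it is absorbed on the left.
  have hRn : ‖R‖ ≤ 2 * q ^ 3 * r := by
    have h1 : ‖R‖ ≤ q ^ 3 * r + 1 / 2 * ‖R‖ := by
      calc ‖R‖ ≤ ‖E * X * (W * S)‖ + ‖E * R * S‖ := by
            conv_lhs => rw [hR2]
            exact norm_add_le _ _
        _ ≤ (N * r) * (q ^ 3 / N) + 1 / 2 * ‖R‖ := by
            gcongr
            · refine (l2_opNorm_mul _ _).trans ?_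
              gcongr
            · refine hRS.trans ?_
              gcongr
        _ = _ := by field_simp
    linarith
  have hERS : ‖E * R * S‖ ≤ 2 * q ^ 5 * (ε * r / N) := by
    refine hRS.trans ?_
    calc q ^ 2 * ε / N * ‖R‖ ≤ q ^ 2 * ε / N * (2 * q ^ 3 * r) := by gcongr
      _ = _ := by ring
  have hq35 : q ^ 3 ≤ q ^ 5 := pow_le_pow_right₀ hq (by norm_num)
  have hrr : r ≤ r ^ 2 := by nlinarith
  -- The product bound ‖X‖‖R‖ has order √N r and would leave an error of order r in X(W - Q). The
  -- smallness of XᵀEX, and of EX through the symmetry of E, saves the factor √N.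
  have hXR : ‖Xᵀ * R‖ ≤ 3 * q ^ 5 * r ^ 2 := by
    have h1 : Xᵀ * R = Xᵀ * E * X * (W * S) + (E * X)ᵀ * R * S := by
      conv_lhs => rw [hR2]
      rw [Matrix.mul_add, Matrix.transpose_mul, hE]
      simp only [Matrix.mul_assoc]
    rw [h1]
    calc _ ≤ ‖Xᵀ * E * X * (W * S)‖ + ‖(E * X)ᵀ * R * S‖ := norm_add_le _ _
      _ ≤ ‖Xᵀ * E * X‖ * ‖W * S‖ + ‖(E * X)ᵀ‖ * ‖R‖ * ‖S‖ := by
          gcongr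
          · exact l2_opNorm_mul _ _
          · exact (l2_opNorm_mul _ _).trans (by gcongr; exact l2_opNorm_mul _ _)
      _ ≤ (N * r) * (q ^ 3 / N) + (N * r) * (2 * q ^ 3 * r) * (q ^ 2 / N) := by
          rw [l2_opNorm_transpose]
          gcongr
      _ = q ^ 3 * r + 2 * q ^ 5 * r ^ 2 := by field_simp
      _ ≤ q ^ 5 * r ^ 2 + 2 * q ^ 5 * r ^ 2 := by gcongr
      _ = _ := by ring
  have hWW : 1 - Wᵀ * W = (Rᵀ * X * W + Rᵀ * R) * S := by
    have h1 : Yᵀ * Y * S = 1 := by rw [hgram, hDS]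
    have h2 : Yᵀ * Y * S = Wᵀ * W + Rᵀ * Y * S := by
      conv_lhs => rw [show Yᵀ = (X * W + R)ᵀ by rw [← hY]]
      rw [Matrix.transpose_add, Matrix.transpose_mul, Matrix.add_mul, Matrix.add_mul]
      simp only [hW, Matrix.mul_assoc]
    rw [← h1, h2, add_sub_cancel_left]
    conv_lhs => rw [hY]
    rw [Matrix.mul_add]
    simp only [Matrix.mul_assoc]
  -- The constant 7 is 3 from RᵀXW plus 4 from RᵀR.
  have hWWn : ‖1 - Wᵀ * W‖ ≤ 7 * q ^ 8 * r ^ 2 / N := by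
    have h1 : ‖Rᵀ * X‖ ≤ 3 * q ^ 5 * r ^ 2 := by
      rw [← l2_opNorm_transpose, Matrix.transpose_mul, Matrix.transpose_transpose]
      exact hXR
    rw [hWW]
    calc _ ≤ ‖Rᵀ * X * W + Rᵀ * R‖ * ‖S‖ := l2_opNorm_mul _ _
      _ ≤ (‖Rᵀ * X‖ * ‖W‖ + ‖Rᵀ‖ * ‖R‖) * ‖S‖ := by
          gcongr
          refine (norm_add_le _ _).trans ?_
          gcongr <;> exact l2_opNorm_mul _ _
      _ ≤ (3 * q ^ 5 * r ^ 2 * q + (2 * q ^ 3 * r) * (2 * q ^ 3 * r)) * (q ^ 2 / N) := by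
          rw [l2_opNorm_transpose]
          gcongr
      _ = _ := by ring
  obtain ⟨Q, hQ, hQW⟩ := exists_orthogonal_norm_sub_le W (hWWn.trans_lt hsmall)
  have hQ1 : Q * Qᵀ = 1 := (Matrix.mem_orthogonalGroup_iff κ ℝ).1 hQ
  have hQn : ‖Qᵀ‖ ≤ 1 := by
    rw [l2_opNorm_transpose]
    exact l2_opNorm_orthogonal_le hQ
  refine ⟨Q, hQ, W * S * Qᵀ, ?_, ?_⟩
  · calc _ ≤ ‖W * S‖ * ‖Qᵀ‖ := l2_opNorm_mul _ _
      _ ≤ q ^ 3 / N * 1 := by gcongr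
      _ ≤ 7 * q ^ 8 / N := by
        rw [mul_one]
        gcongr
        have : q ^ 3 ≤ q ^ 8 := pow_le_pow_right₀ hq (by norm_num)
        have : 0 < q ^ 8 := by positivity
        linarith
  · have h1 : Y * Qᵀ - X - E * X * (W * S * Qᵀ) = (X * (W - Q) + E * R * S) * Qᵀ := by
      have : X = X * (Q * Qᵀ) := by rw [hQ1, Matrix.mul_one]
      conv_lhs => rw [hY, hR2]
      nth_rewrite 3 [this]
      simp only [Matrix.add_mul, Matrix.mul_sub, Matrix.sub_mul, Matrix.mul_assoc]
      abel
    rw [h1]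
    calc _ ≤ ‖X * (W - Q) + E * R * S‖ * ‖Qᵀ‖ := l2_opNorm_mul _ _
      _ ≤ ‖X * (W - Q) + E * R * S‖ * 1 := by gcongr
      _ ≤ ‖X‖ * ‖W - Q‖ + ‖E * R * S‖ := by
          rw [mul_one]
          refine (norm_add_le _ _).trans ?_
          gcongr
          exact l2_opNorm_mul _ _
      _ ≤ √N * (7 * q ^ 8 * r ^ 2 / N) + 2 * q ^ 5 * (ε * r / N) := by
          gcongr
          exact hQW.trans hWWn
      _ = 7 * q ^ 8 * (r ^ 2 / √N) + 2 * q ^ 5 * (ε * r / N) := by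
          congr 1
          nth_rewrite 2 [← hsN2]
          field_simp
      _ ≤ 7 * q ^ 8 * (r ^ 2 / √N) + 7 * q ^ 8 * (ε * r / N) := by
          have h58 : q ^ 5 ≤ q ^ 8 := pow_le_pow_right₀ hq (by norm_num)
          gcongr
          norm_num
      _ = _ := by ring

end Embedding

/-! ### Leading eigenvalues of the signal plus noise matrix. -/

section Eigenvalues

open Matrix
open scoped Matrix.Norms.L2Operator

variable {ι κ : Type*} [Fintype ι] [Fintype κ]

theorem dotProduct_self_nonneg (u : ι → ℝ) : 0 ≤ u ⬝ᵥ u :=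
  Finset.sum_nonneg fun i _ => mul_self_nonneg (u i)

theorem dotProduct_sq_le (u v : ι → ℝ) : (u ⬝ᵥ v) ^ 2 ≤ (u ⬝ᵥ u) * (v ⬝ᵥ v) := by
  simpa [dotProduct, sq] using Finset.sum_mul_sq_le_sq_mul_sq Finset.univ u v

theorem dotProduct_mulVec_transpose (A : Matrix ι κ ℝ) (u : ι → ℝ) (v : κ → ℝ) :
    u ⬝ᵥ (A *ᵥ v) = (Aᵀ *ᵥ u) ⬝ᵥ v := by
  rw [dotProduct_mulVec, mulVec_transpose]

/-- On the column space of X the matrix XXᵀ expands by at least τ. With v = Xu and w = Xᵀv,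
Cauchy–Schwarz on ‖v‖² = ⟨w, u⟩ gives τ‖v‖² ≤ ‖w‖², and Cauchy–Schwarz on ‖w‖² = ⟨v, Xw⟩ finishes.
-/
theorem sq_mul_le_gram_of_lower_bound {X : Matrix ι κ ℝ} {τ : ℝ} (hτ0 : 0 < τ)
    (hτ : ∀ u, τ * (u ⬝ᵥ u) ≤ (X *ᵥ u) ⬝ᵥ (X *ᵥ u)) (u : κ → ℝ) :
    τ ^ 2 * ((X *ᵥ u) ⬝ᵥ (X *ᵥ u)) ≤
      ((X * Xᵀ) *ᵥ (X *ᵥ u)) ⬝ᵥ ((X * Xᵀ) *ᵥ (X *ᵥ u)) := by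
  set v := X *ᵥ u with hv
  set w := Xᵀ *ᵥ v with hw
  have hPv : (X * Xᵀ) *ᵥ v = X *ᵥ w := (mulVec_mulVec v X Xᵀ).symm
  rw [hPv]
  have h1 : (v ⬝ᵥ v) = w ⬝ᵥ u := by
    conv_lhs => rw [hv]
    rw [← hv, dotProduct_mulVec_transpose]
  have h2 : w ⬝ᵥ w = v ⬝ᵥ (X *ᵥ w) := (dotProduct_mulVec_transpose X v w).symm
  have h3 := dotProduct_sq_le w u
  have h4 := dotProduct_sq_le v (X *ᵥ w)
  rw [← h1] at h3
  rw [← h2] at h4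
  have h5 := hτ u
  rw [← hv] at h5
  have hvv : 0 ≤ v ⬝ᵥ v := dotProduct_self_nonneg v
  have hww : 0 ≤ w ⬝ᵥ w := dotProduct_self_nonneg w
  rcases hvv.eq_or_lt with h0 | hpos
  · rw [← h0, mul_zero]
    exact dotProduct_self_nonneg _
  have h6 : τ * (v ⬝ᵥ v) ≤ w ⬝ᵥ w := by
    refine le_of_mul_le_mul_right ?_ hpos
    nlinarith [mul_le_mul_of_nonneg_left h3 hτ0.le, mul_le_mul_of_nonneg_left h5 hww]
  have h7 : τ * (v ⬝ᵥ v) * (τ * (v ⬝ᵥ v)) ≤ (w ⬝ᵥ w) ^ 2 := by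
    rw [sq]
    gcongr
  refine le_of_mul_le_mul_right ?_ hpos
  nlinarith

/-- If the Gram matrix `XᵀX` is bounded below by `τ` and `E` is small compared to `τ`, then the
leading eigenvalues of `XXᵀ + E` are positive and at least `τ / 2`. -/
theorem IsASE.exists_gram_eq_diagonal {n d : ℕ} {A : Matrix (Fin n) (Fin n) ℝ}
    {Xhat : Fin n → EuclideanSpace ℝ (Fin d)} (hA : IsASE A Xhat)
    {X : Matrix (Fin n) (Fin d) ℝ} {E : Matrix (Fin n) (Fin n) ℝ} (hE : Eᵀ = E)
    (hAE : X * Xᵀ + E = A) {τ ε : ℝ} (hτ0 : 0 < τ)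
    (hτ : ∀ u, τ * (u ⬝ᵥ u) ≤ (X *ᵥ u) ⬝ᵥ (X *ᵥ u)) (hEn : ‖E‖ ≤ ε) (hετ : ε < τ / 2) :
    ∃ ev : Fin d → ℝ, (∀ s, τ / 2 ≤ ev s) ∧
      (Matrix.of fun i s => Xhat i s)ᵀ * (Matrix.of fun i s => Xhat i s) = diagonal ev ∧
      A * (Matrix.of fun i s => Xhat i s) = (Matrix.of fun i s => Xhat i s) * diagonal ev := by
  obtain ⟨hdn, b, ev, hb, hord, hX⟩ := hA
  have hε0 : 0 ≤ ε := (norm_nonneg _).trans hEn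
  have hAt : Aᵀ = A := by
    rw [← hAE, Matrix.transpose_add, Matrix.transpose_mul, Matrix.transpose_transpose, hE]
  have hbk (k) : A *ᵥ (b k).ofLp = ev k • (b k).ofLp := congrArg WithLp.ofLp (hb k)
  have hbb (k l) : (b k).ofLp ⬝ᵥ (b l).ofLp = if k = l then 1 else 0 := by
    have := b.inner_eq_ite k l
    rw [EuclideanSpace.inner_eq_star_dotProduct, dotProduct_comm] at this
    simpa using this
  have hparseval (v : Fin n → ℝ) : v ⬝ᵥ v = ∑ k, ((b k).ofLp ⬝ᵥ v) ^ 2 := by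
    have := b.sum_sq_norm_inner_right (WithLp.toLp 2 v)
    rw [norm_toLp_sq] at this
    rw [← this]
    refine Finset.sum_congr rfl fun k _ => ?_
    rw [EuclideanSpace.inner_eq_star_dotProduct, dotProduct_comm, Real.norm_eq_abs, sq_abs]
    simp
  -- A Courant–Fischer argument: the s < d conditions of orthogonality to the first s eigenvectors
  -- leave some v = Xu ≠ 0. On it A stretches by at most |ev s|, but by at least τ - ε.
  have hmag (s : Fin d) : τ - ε ≤ |ev (Fin.castLE hdn s)| := by
    set M : Matrix (Fin s) (Fin d) ℝ :=
      (Matrix.of fun (j : Fin s) i => b (Fin.castLE (s.2.le.trans hdn) j) i) * X with hM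
    have hker : LinearMap.ker (Matrix.mulVecLin M) ≠ ⊥ :=
      LinearMap.ker_ne_bot_of_finrank_lt (by simp)
    obtain ⟨u, hu, hu0⟩ := (Submodule.ne_bot_iff _).1 hker
    set v := X *ᵥ u with hv
    have hort (k : Fin n) (hk : (k : ℕ) < s) : (b k).ofLp ⬝ᵥ v = 0 := by
      have h1 := congrFun (LinearMap.mem_ker.1 hu) ⟨k, hk⟩
      rw [mulVecLin_apply, hM, ← mulVec_mulVec, ← hv] at h1
      exact h1
    have huu : 0 < u ⬝ᵥ u := (dotProduct_self_nonneg u).lt_of_ne'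
      fun h => hu0 (dotProduct_self_eq_zero.1 h)
    have hvv : 0 < v ⬝ᵥ v := (mul_pos hτ0 huu).trans_le (hτ u)
    have hAv : (A *ᵥ v) ⬝ᵥ (A *ᵥ v) ≤ ev (Fin.castLE hdn s) ^ 2 * (v ⬝ᵥ v) := by
      rw [hparseval (A *ᵥ v), hparseval v, Finset.mul_sum]
      refine Finset.sum_le_sum fun k _ => ?_
      rw [dotProduct_mulVec_transpose, hAt, hbk, smul_dotProduct, smul_eq_mul, mul_pow]
      by_cases hk : (k : ℕ) < s
      · rw [hort k hk]; simp
      · gcongr ?_ * _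
        refine sq_le_sq.2 (hord _ _ ?_)
        rw [Fin.le_def]
        simpa using hk
    have hgram := sq_mul_le_gram_of_lower_bound hτ0 hτ u
    rw [← hv] at hgram
    have hEv := mulVec_dotProduct_mulVec_le E v
    have hn1 : ‖WithLp.toLp 2 (A *ᵥ v)‖ ≤ |ev (Fin.castLE hdn s)| * ‖WithLp.toLp 2 v‖ := by
      refine le_of_sq_le_sq ?_ (by positivity)
      rwa [mul_pow, sq_abs, norm_toLp_sq, norm_toLp_sq]
    have hn2 : τ * ‖WithLp.toLp 2 v‖ ≤ ‖WithLp.toLp 2 ((X * Xᵀ) *ᵥ v)‖ := by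
      refine le_of_sq_le_sq ?_ (by positivity)
      rwa [mul_pow, norm_toLp_sq, norm_toLp_sq]
    have hn3 : ‖WithLp.toLp 2 (E *ᵥ v)‖ ≤ ‖E‖ * ‖WithLp.toLp 2 v‖ := by
      refine le_of_sq_le_sq ?_ (by positivity)
      rwa [mul_pow, norm_toLp_sq, norm_toLp_sq]
    have hn4 : 0 < ‖WithLp.toLp 2 v‖ := by
      refine (norm_nonneg _).lt_of_ne' fun h => hvv.ne' ?_
      rw [← norm_toLp_sq, h]; simp
    have hn5 : ‖WithLp.toLp 2 ((X * Xᵀ) *ᵥ v)‖ ≤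
        ‖WithLp.toLp 2 (A *ᵥ v)‖ + ‖WithLp.toLp 2 (E *ᵥ v)‖ := by
      rw [← hAE, Matrix.add_mulVec, WithLp.toLp_add]
      exact norm_le_add_norm_add _ _
    refine le_of_mul_le_mul_right ?_ hn4
    nlinarith
  -- Since XXᵀ is positive semidefinite, no eigenvalue lies below -ε. As τ - ε > ε, an eigenvalue of
  -- magnitude at least τ - ε must be positive.
  have hpos (k : Fin n) : -ε ≤ ev k := by
    have h1 : ev k = (b k).ofLp ⬝ᵥ (A *ᵥ (b k).ofLp) := by
      rw [hbk, dotProduct_smul, hbb]; simp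
    have h2 : (b k).ofLp ⬝ᵥ ((X * Xᵀ) *ᵥ (b k).ofLp) =
        (Xᵀ *ᵥ (b k).ofLp) ⬝ᵥ (Xᵀ *ᵥ (b k).ofLp) := by
      rw [← mulVec_mulVec, dotProduct_mulVec_transpose]
    have h3 := dotProduct_sq_le (b k).ofLp (E *ᵥ (b k).ofLp)
    have h4 := mulVec_dotProduct_mulVec_le E (b k).ofLp
    rw [hbb, if_pos rfl] at h3 h4
    rw [h1, ← hAE, Matrix.add_mulVec, dotProduct_add, h2]
    have h5 : |(b k).ofLp ⬝ᵥ (E *ᵥ (b k).ofLp)| ≤ ‖E‖ :=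
      abs_le_of_sq_le_sq (by linarith) (norm_nonneg _)
    have h6 : 0 ≤ (Xᵀ *ᵥ (b k).ofLp) ⬝ᵥ (Xᵀ *ᵥ (b k).ofLp) := dotProduct_self_nonneg _
    have := (abs_le.1 h5).1
    linarith
  have hev (s : Fin d) : τ / 2 ≤ ev (Fin.castLE hdn s) := by
    rcases le_abs'.1 (hmag s) with h | h
    · linarith [hpos (Fin.castLE hdn s)]
    · linarith
  refine ⟨fun s => ev (Fin.castLE hdn s), hev, ?_, ?_⟩
  · ext s t
    have h1 : ((Matrix.of fun i s => Xhat i s)ᵀ * (Matrix.of fun i s => Xhat i s)) s t =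
        ((b (Fin.castLE hdn s)).ofLp ⬝ᵥ (b (Fin.castLE hdn t)).ofLp) *
          (√|ev (Fin.castLE hdn s)| * √|ev (Fin.castLE hdn t)|) := by
      rw [Matrix.mul_apply, dotProduct, Finset.sum_mul]
      refine Finset.sum_congr rfl fun i _ => ?_
      simp only [transpose_apply, of_apply, hX]
      ring
    rw [h1, hbb, diagonal_apply]
    by_cases hst : s = t
    · subst hst
      rw [if_pos rfl, if_pos rfl, Real.mul_self_sqrt (abs_nonneg _), one_mul,
        abs_of_nonneg (by linarith [hev s])]
    · rw [if_neg hst, if_neg (by simpa using hst), zero_mul]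
  · ext i s
    have h1 := congrFun (hbk (Fin.castLE hdn s)) i
    rw [mul_diagonal, Matrix.mul_apply]
    simp only [of_apply, hX]
    simp only [mulVec, dotProduct, Pi.smul_apply, smul_eq_mul] at h1
    simp_rw [← mul_assoc]
    rw [← Finset.sum_mul, h1]
    ring

end Eigenvalues

/-! ### Operator norm from bilinear forms in sign vectors. -/

section CutNorm

open Matrix
open scoped Matrix.Norms.L2Operator

/-- The vector of signs `±1` encoded by a Boolean vector. -/
def signVector {ι : Type*} (s : ι → Bool) (i : ι) : ℝ := if s i then 1 else -1

theorem abs_signVector {ι : Type*} (s : ι → Bool) (i : ι) : |signVector s i| = 1 := by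
  unfold signVector
  split_ifs <;> simp

variable {ι : Type*} [Fintype ι]

theorem exists_signVector_dotProduct_eq (a : ι → ℝ) :
    ∃ s : ι → Bool, signVector s ⬝ᵥ a = ∑ i, |a i| := by
  refine ⟨fun i => decide (0 ≤ a i), Finset.sum_congr rfl fun i _ => ?_⟩
  by_cases h : 0 ≤ a i
  · simp [signVector, h, abs_of_nonneg h]
  · simp [signVector, h, abs_of_neg (not_le.1 h)]

theorem dotProduct_le_sum_abs {u : ι → ℝ} (hu : ∀ i, |u i| ≤ 1) (a : ι → ℝ) :
    u ⬝ᵥ a ≤ ∑ i, |a i| := by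
  refine Finset.sum_le_sum fun i _ => (le_abs_self _).trans ?_
  rw [abs_mul]
  exact mul_le_of_le_one_left (abs_nonneg _) (hu i)

/-- A bilinear form on a product of cubes is maximal at vertices: u is replaced by the signs of Ev,
then v by the signs of Eᵀs. -/
theorem dotProduct_mulVec_le_of_signVector {E : Matrix ι ι ℝ} {B : ℝ}
    (hB : ∀ s t : ι → Bool, signVector s ⬝ᵥ (E *ᵥ signVector t) ≤ B) {u v : ι → ℝ}
    (hu : ∀ i, |u i| ≤ 1) (hv : ∀ i, |v i| ≤ 1) : u ⬝ᵥ (E *ᵥ v) ≤ B := by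
  obtain ⟨s, hs⟩ := exists_signVector_dotProduct_eq (E *ᵥ v)
  obtain ⟨t, ht⟩ := exists_signVector_dotProduct_eq (Eᵀ *ᵥ signVector s)
  calc u ⬝ᵥ (E *ᵥ v) ≤ signVector s ⬝ᵥ (E *ᵥ v) := hs ▸ dotProduct_le_sum_abs hu _
    _ = v ⬝ᵥ (Eᵀ *ᵥ signVector s) := by rw [dotProduct_mulVec_transpose, dotProduct_comm]
    _ ≤ signVector t ⬝ᵥ (Eᵀ *ᵥ signVector s) := ht ▸ dotProduct_le_sum_abs hv _
    _ = signVector s ⬝ᵥ (E *ᵥ signVector t) := by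
        rw [dotProduct_mulVec_transpose, Matrix.transpose_transpose, dotProduct_comm]
    _ ≤ B := hB s t

/-- For symmetric E, ‖E‖⁴ = ‖E²‖² is at most the squared Frobenius norm of E². That splits into one
bilinear form of E for each pair of rows (i, l), with vectors in the cube [-1, 1]. Thus only
finitely many sign vectors need a probabilistic bound. -/
theorem l2_opNorm_pow_four_le [DecidableEq ι] {E : Matrix ι ι ℝ} (hE : Eᵀ = E)
    (hE1 : ∀ i j, |E i j| ≤ 1) {B : ℝ}
    (hB : ∀ s t : ι → Bool, signVector s ⬝ᵥ (E *ᵥ signVector t) ≤ B) :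
    ‖E‖ ^ 4 ≤ Fintype.card ι ^ 2 * B := by
  have hEs (i j) : E i j = E j i := congrFun (congrFun hE.symm i) j
  have h1 : ‖E * E‖ = ‖E‖ ^ 2 := by
    have := l2_opNorm_conjTranspose_mul_self E
    rw [conjTranspose_eq_transpose_of_trivial, hE] at this
    rw [this, sq]
  have h2 : ‖E‖ ^ 4 ≤ ∑ i, ∑ j, (E * E) i j ^ 2 := by
    calc ‖E‖ ^ 4 = ‖E * E‖ ^ 2 := by rw [h1]; ring
      _ ≤ _ := l2_opNorm_sq_le_sum_sq _
  have h3 : ∑ i, ∑ j, (E * E) i j ^ 2 = ∑ i, ∑ l, (E i l • E i) ⬝ᵥ (E *ᵥ E l) := by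
    refine Finset.sum_congr rfl fun i _ => ?_
    have hsq (j : ι) : (E * E) i j ^ 2 = ∑ l, E i l * E l j * (E * E) i j := by
      rw [sq, ← Finset.sum_mul]
      rfl
    simp_rw [hsq]
    rw [Finset.sum_comm]
    refine Finset.sum_congr rfl fun l _ => ?_
    rw [smul_dotProduct, smul_eq_mul, dotProduct_mulVec_transpose, hE]
    simp only [dotProduct, mulVec, Matrix.mul_apply]
    rw [Finset.mul_sum]
    refine Finset.sum_congr rfl fun j _ => ?_
    rw [mul_right_comm, mul_assoc]
    congr 2
    exact Finset.sum_congr rfl fun k _ => by rw [hEs k j, mul_comm]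
  rw [h3] at h2
  refine h2.trans ?_
  calc _ ≤ ∑ _i : ι, ∑ _l : ι, B := by
        refine Finset.sum_le_sum fun i _ => Finset.sum_le_sum fun l _ => ?_
        refine dotProduct_mulVec_le_of_signVector hB (fun k => ?_) (hE1 l)
        rw [Pi.smul_apply, smul_eq_mul, abs_mul]
        exact mul_le_one₀ (hE1 i l) (abs_nonneg _) (hE1 i k)
    _ = _ := by simp; ring

end CutNorm

/-! ### Sums over vertex pairs and over all graphs. -/

section GraphSum

variable {n : ℕ}

/-- The pairs `i < j` of vertices. -/
def pairs (n : ℕ) : Finset (Fin n × Fin n) := Finset.univ.filter fun e => e.1 < e.2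

theorem mem_pairs {e : Fin n × Fin n} : e ∈ pairs n ↔ e.1 < e.2 := by simp [pairs]

theorem sum_sum_eq_sum_pairs (f : Fin n → Fin n → ℝ) :
    ∑ i, ∑ j, f i j = ∑ e ∈ pairs n, (f e.1 e.2 + f e.2 e.1) + ∑ i, f i i := by
  have h1 : ∑ e ∈ pairs n, f e.2 e.1 = ∑ e : Fin n × Fin n with e.2 < e.1, f e.1 e.2 :=
    Finset.sum_bij' (fun e _ => e.swap) (fun e _ => e.swap) (by simp [pairs]) (by simp [pairs])
      (by simp) (by simp) (by simp)
  have h2 : ∑ i, f i i = ∑ e : Fin n × Fin n with e.1 = e.2, f e.1 e.2 :=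
    Finset.sum_bij' (fun i _ => (i, i)) (fun e _ => e.1) (by simp) (by simp) (by simp)
      (by rintro ⟨a, b⟩; simp) (by simp)
  rw [Finset.sum_add_distrib, h1, h2, ← Fintype.sum_prod_type', pairs, Finset.sum_filter,
    Finset.sum_filter, Finset.sum_filter, ← Finset.sum_add_distrib, ← Finset.sum_add_distrib]
  refine Finset.sum_congr rfl fun e _ => ?_
  rcases lt_trichotomy e.1 e.2 with h | h | h
  · simp [h, h.not_gt, h.ne]
  · simp [h]
  · simp [h, h.not_gt, h.ne']

-- A graph is the same as a subset of the pairs i < j, so expanding the product over pairs runs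
-- through all graphs. This identity plays the role of independence of the edges.
open Classical in
theorem sum_graph_prod (f k : Fin n × Fin n → ℝ) :
    ∑ g : SimpleGraph (Fin n), ∏ e ∈ pairs n, (if g.Adj e.1 e.2 then f e else k e) =
      ∏ e ∈ pairs n, (f e + k e) := by
  rw [Finset.prod_add]
  refine Finset.sum_bij' (fun g _ => (pairs n).filter fun e => g.Adj e.1 e.2)
    (fun t _ => SimpleGraph.fromRel fun i j => (i, j) ∈ t) (by simp) (by simp) ?_ ?_ ?_
  · intro g _
    ext i j
    simp only [SimpleGraph.fromRel_adj, Finset.mem_filter, mem_pairs]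
    refine ⟨?_, fun h => ⟨h.ne, ?_⟩⟩
    · rintro ⟨_, h | h⟩
      exacts [h.2, h.2.symm]
    · rcases lt_or_gt_of_ne h.ne with h' | h'
      exacts [Or.inl ⟨h', h⟩, Or.inr ⟨h', h.symm⟩]
  · intro t ht
    rw [Finset.mem_powerset] at ht
    ext e
    simp only [SimpleGraph.fromRel_adj, Finset.mem_filter, mem_pairs]
    refine ⟨?_, fun h => ⟨mem_pairs.1 (ht h), (mem_pairs.1 (ht h)).ne, Or.inl h⟩⟩
    rintro ⟨h, _, h1 | h1⟩
    · exact h1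
    · exact absurd (mem_pairs.1 (ht h1)) h.not_gt
  · intro g _
    rw [Finset.prod_ite, Finset.filter_not]

end GraphSum

/-! ### Exponential tail bounds for the edges at fixed latent positions. -/

section Chernoff

theorem exp_le_add_exp_sq (y : ℝ) : Real.exp y ≤ y + Real.exp (y ^ 2) := by
  rcases le_or_gt |y| 1 with h | h
  · have h1 := (abs_le.1 (Real.abs_exp_sub_one_sub_id_le h)).2
    have h2 := Real.add_one_le_exp (y ^ 2)
    linarith
  · rcases lt_abs.1 h with h | h
    · have : Real.exp y ≤ Real.exp (y ^ 2) := Real.exp_le_exp.2 (by nlinarith)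
      linarith
    · have h1 : Real.exp y ≤ 1 := Real.exp_le_one_iff.2 (by linarith)
      have h2 := Real.add_one_le_exp (y ^ 2)
      nlinarith

/-- Averaging e^y ≤ y + e^(y²) over the two outcomes kills the linear terms, since the variable is
centred; its values have modulus at most 1. -/
theorem bernoulli_mgf_le {p : ℝ} (hp0 : 0 ≤ p) (hp1 : p ≤ 1) (w : ℝ) :
    p * Real.exp (w * (1 - p)) + (1 - p) * Real.exp (w * (0 - p)) ≤ Real.exp (w ^ 2) := by
  have h1 : Real.exp (w * (1 - p)) ≤ w * (1 - p) + Real.exp (w ^ 2) := by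
    refine (exp_le_add_exp_sq _).trans (add_le_add le_rfl (Real.exp_le_exp.2 ?_))
    nlinarith [mul_nonneg (sq_nonneg w) (mul_nonneg hp0 (by linarith : (0 : ℝ) ≤ 2 - p))]
  have h2 : Real.exp (w * (0 - p)) ≤ w * (0 - p) + Real.exp (w ^ 2) := by
    refine (exp_le_add_exp_sq _).trans (add_le_add le_rfl (Real.exp_le_exp.2 ?_))
    nlinarith [mul_nonneg (sq_nonneg w) (mul_nonneg (by linarith : (0 : ℝ) ≤ 1 + p)
      (by linarith : (0 : ℝ) ≤ 1 - p))]
  have h3 := mul_le_mul_of_nonneg_left h1 hp0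
  have h4 := mul_le_mul_of_nonneg_left h2 (by linarith : 0 ≤ 1 - p)
  nlinarith

variable {n d : ℕ}

open Classical in
/-- The centred edge indicator of the pair `e` in the graph `g`. -/
def edgeNoise (x : Fin n → EuclideanSpace ℝ (Fin d)) (g : SimpleGraph (Fin n))
    (e : Fin n × Fin n) : ℝ :=
  (if g.Adj e.1 e.2 then 1 else 0) - inner ℝ (x e.1) (x e.2)

theorem graphProb_nonneg {x : Fin n → EuclideanSpace ℝ (Fin d)}
    (hx : ∀ i j, 0 ≤ inner ℝ (x i) (x j) ∧ inner ℝ (x i) (x j) ≤ 1) (g : SimpleGraph (Fin n)) :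
    0 ≤ graphProb x g := by
  refine Finset.prod_nonneg fun e _ => ?_
  split_ifs
  · exact (hx _ _).1
  · linarith [(hx e.1 e.2).2]

theorem sum_graphProb (x : Fin n → EuclideanSpace ℝ (Fin d)) : ∑ g, graphProb x g = 1 := by
  classical
  have := sum_graph_prod (fun e : Fin n × Fin n => inner ℝ (x e.1) (x e.2))
    (fun e => 1 - inner ℝ (x e.1) (x e.2))
  simp only [add_sub_cancel, Finset.prod_const_one] at this
  rw [← this]
  exact Finset.sum_congr rfl fun g _ => Finset.prod_congr rfl fun e _ => by congr

theorem sum_graphProb_mul_exp_le {x : Fin n → EuclideanSpace ℝ (Fin d)}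
    (hx : ∀ i j, 0 ≤ inner ℝ (x i) (x j) ∧ inner ℝ (x i) (x j) ≤ 1) (w : Fin n × Fin n → ℝ) :
    ∑ g, graphProb x g * Real.exp (∑ e ∈ pairs n, w e * edgeNoise x g e) ≤
      Real.exp (∑ e ∈ pairs n, w e ^ 2) := by
  classical
  have h := sum_graph_prod
    (fun e : Fin n × Fin n => inner ℝ (x e.1) (x e.2) *
      Real.exp (w e * (1 - inner ℝ (x e.1) (x e.2))))
    (fun e => (1 - inner ℝ (x e.1) (x e.2)) * Real.exp (w e * (0 - inner ℝ (x e.1) (x e.2))))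
  rw [Real.exp_sum]
  calc _ = _ := ?_
    _ ≤ _ := (h.trans_le (Finset.prod_le_prod (fun e _ => ?_)
      fun e _ => bernoulli_mgf_le (hx _ _).1 (hx _ _).2 _))
  · refine Finset.sum_congr rfl fun g _ => ?_
    rw [Real.exp_sum, graphProb, pairs, ← Finset.prod_mul_distrib]
    refine Finset.prod_congr rfl fun e _ => ?_
    unfold edgeNoise
    by_cases hg : g.Adj e.1 e.2 <;> simp [hg]
  · have := hx e.1 e.2
    have : 0 ≤ 1 - inner ℝ (x e.1) (x e.2) := by linarith
    positivity [(hx e.1 e.2).1]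

open Classical in
theorem sum_graphProb_tail_le {x : Fin n → EuclideanSpace ℝ (Fin d)}
    (hx : ∀ i j, 0 ≤ inner ℝ (x i) (x j) ∧ inner ℝ (x i) (x j) ≤ 1) (w : Fin n × Fin n → ℝ)
    {V t : ℝ} (hV : 0 < V) (hw : ∑ e ∈ pairs n, w e ^ 2 ≤ V) (ht : 0 ≤ t) :
    ∑ g, (if t ≤ ∑ e ∈ pairs n, w e * edgeNoise x g e then graphProb x g else 0) ≤
      Real.exp (-t ^ 2 / (4 * V)) := by
  -- The minimiser of the Chernoff exponent l²V - lt.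
  set l := t / (2 * V) with hl
  have hl0 : 0 ≤ l := by positivity
  have h := sum_graphProb_mul_exp_le hx (fun e => l * w e)
  have h1 : ∑ g, (if t ≤ ∑ e ∈ pairs n, w e * edgeNoise x g e then graphProb x g else 0) ≤
      Real.exp (-(l * t)) *
        ∑ g, graphProb x g * Real.exp (∑ e ∈ pairs n, l * w e * edgeNoise x g e) := by
    rw [Finset.mul_sum]
    refine Finset.sum_le_sum fun g _ => ?_
    have hg := graphProb_nonneg hx g
    split_ifs with hT
    · rw [mul_left_comm, ← Real.exp_add]
      refine le_mul_of_one_le_right hg (Real.one_le_exp ?_)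
      simp_rw [mul_assoc]
      rw [← Finset.mul_sum]
      nlinarith
    · positivity
  refine h1.trans ((mul_le_mul_of_nonneg_left h (Real.exp_pos _).le).trans ?_)
  rw [← Real.exp_add]
  refine Real.exp_le_exp.2 ?_
  simp_rw [mul_pow]
  rw [← Finset.mul_sum]
  have h2 : -(l * t) + l ^ 2 * V = -t ^ 2 / (4 * V) := by
    rw [hl]; field_simp; ring
  rw [← h2]
  gcongr

end Chernoff

/-! ### From fixed latent positions to the random graph. -/

section Transfer

open Classical in
/-- The adjacency matrix of `g`. -/
abbrev adj {n : ℕ} (g : SimpleGraph (Fin n)) : Matrix (Fin n) (Fin n) ℝ := g.adjMatrix ℝ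

/-- The matrix `A - XXᵀ`. -/
def noise {n d : ℕ} (A : Matrix (Fin n) (Fin n) ℝ) (x : Fin n → EuclideanSpace ℝ (Fin d)) :
    Matrix (Fin n) (Fin n) ℝ :=
  Matrix.of fun i j => A i j - inner ℝ (x i) (x j)

variable {Ω : Type*} [MeasurableSpace Ω] {μ : Measure Ω}
  {n d : ℕ} {F : Measure (EuclideanSpace ℝ (Fin d))}
  {A : Ω → Matrix (Fin n) (Fin n) ℝ} {X : Ω → Fin n → EuclideanSpace ℝ (Fin d)}

theorem IsInnerProductDistribution.ae_pi_mem_support (hF : IsInnerProductDistribution F) :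
    ∀ᵐ x ∂(Measure.pi fun _ : Fin n => F), ∀ i, x i ∈ F.support := by
  have := hF.isProbabilityMeasure
  rw [ae_all_iff]
  intro i
  exact (Measure.tendsto_eval_ae_ae (μ := fun _ : Fin n => F) (i := i)).eventually
    Measure.support_mem_ae

theorem IsRDPG.ae_mem_support (h : IsRDPG μ F n A X) (hF : IsInnerProductDistribution F) :
    ∀ᵐ ω ∂μ, ∀ i, X ω i ∈ F.support := by
  refine ae_of_ae_map (p := fun x => ∀ i, x i ∈ F.support) h.measurable_X.aemeasurable ?_
  rw [h.law_X]
  exact hF.ae_pi_mem_support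

theorem measurable_graphProb (g : SimpleGraph (Fin n)) :
    Measurable fun x : Fin n → EuclideanSpace ℝ (Fin d) => graphProb x g := by
  classical
  unfold graphProb
  refine Finset.measurable_prod _ fun e _ => ?_
  split_ifs
  · exact (measurable_pi_apply _).inner (measurable_pi_apply _)
  · exact measurable_const.sub ((measurable_pi_apply _).inner (measurable_pi_apply _))

theorem IsRDPG.measurableSet_eq (h : IsRDPG μ F n A X) (M : Matrix (Fin n) (Fin n) ℝ) :
    MeasurableSet {ω | A ω = M} := by
  have : {ω | A ω = M} = ⋂ i, ⋂ j, (fun ω => A ω i j) ⁻¹' {M i j} := by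
    ext ω
    simp [← Matrix.ext_iff]
  rw [this]
  exact .iInter fun i => .iInter fun j => h.measurable_A i j (measurableSet_singleton _)

/-- The events A = adj g are disjoint, and their probabilities sum to 1 by `sum_graphProb`. -/
theorem IsRDPG.ae_exists_adj [IsProbabilityMeasure μ] (h : IsRDPG μ F n A X) (hF : IsInnerProductDistribution F) :
    ∀ᵐ ω ∂μ, ∃ g, A ω = adj g := by
  classical
  have := hF.isProbabilityMeasure
  have hset : {ω | ∃ g, A ω = adj g} = ⋃ g, {ω | A ω = adj g} := by ext; simp
  have hms : MeasurableSet {ω | ∃ g, A ω = adj g} := by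
    rw [hset]
    exact .iUnion fun g => h.measurableSet_eq _
  refine (prob_compl_eq_zero_iff hms).2 ?_
  rw [hset, measure_iUnion (fun g g' hg => ?_) fun g => h.measurableSet_eq _, tsum_fintype]
  · have h1 (g : SimpleGraph (Fin n)) : μ {ω | A ω = adj g} =
        ∫⁻ x, ENNReal.ofReal (graphProb x g) ∂(Measure.pi fun _ : Fin n => F) := by
      have := h.cond_law_A g Set.univ .univ
      rw [setLIntegral_univ] at this
      rw [← this]
      congr 1
      ext ω
      simp only [Set.mem_univ, true_and]
    simp_rw [h1]
    rw [← lintegral_finsetSum _ fun g _ => (measurable_graphProb g).ennreal_ofReal]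
    rw [lintegral_congr_ae (g := fun _ => 1)]
    · simp
    · filter_upwards [hF.ae_pi_mem_support] with x hx
      rw [← ENNReal.ofReal_sum_of_nonneg
        fun g _ => graphProb_nonneg (fun i j => hF.inner_mem _ (hx i) _ (hx j)) g,
        sum_graphProb, ENNReal.ofReal_one]
  · refine Set.disjoint_left.2 fun ω h1 h2 => hg ?_
    have h3 : adj g = adj g' := h1.symm.trans h2
    ext i j
    have h4 := congrFun (congrFun h3 i) j
    simp only [adj, SimpleGraph.adjMatrix_apply] at h4
    by_cases ha : g.Adj i j <;> by_cases hb : g'.Adj i j <;> simp_all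

-- A bound on the conditional probability, uniform over latent positions in the support, integrates
-- to a bound on the probability. The set of positions may vary with the graph, so the event can
-- couple A and X.
open Classical in
theorem IsRDPG.measure_exists_le (h : IsRDPG μ F n A X) (hF : IsInnerProductDistribution F)
    {T : SimpleGraph (Fin n) → Set (Fin n → EuclideanSpace ℝ (Fin d))}
    (hT : ∀ g, MeasurableSet (T g)) {δ : ℝ}
    (hδ : ∀ x : Fin n → EuclideanSpace ℝ (Fin d), (∀ i, x i ∈ F.support) →
      ∑ g, (if x ∈ T g then graphProb x g else 0) ≤ δ) :
    μ {ω | ∃ g, A ω = adj g ∧ X ω ∈ T g} ≤ ENNReal.ofReal δ := by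
  have := hF.isProbabilityMeasure
  have hset : {ω | ∃ g, A ω = adj g ∧ X ω ∈ T g} = ⋃ g, {ω | X ω ∈ T g ∧ A ω = adj g} := by
    ext
    simp [and_comm]
  rw [hset]
  refine (measure_iUnion_fintype_le _ _).trans ?_
  calc ∑ g, μ {ω | X ω ∈ T g ∧ A ω = adj g}
      = ∑ g, ∫⁻ x, (T g).indicator (fun x => ENNReal.ofReal (graphProb x g)) x
          ∂(Measure.pi fun _ : Fin n => F) :=
        Finset.sum_congr rfl fun g _ => by
          rw [lintegral_indicator (hT g)]; exact h.cond_law_A g (T g) (hT g)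
    _ = ∫⁻ x, ∑ g, (T g).indicator (fun x => ENNReal.ofReal (graphProb x g)) x
          ∂(Measure.pi fun _ : Fin n => F) :=
        (lintegral_finsetSum _ fun g _ => (measurable_graphProb g).ennreal_ofReal.indicator (hT g)).symm
    _ ≤ ∫⁻ _, ENNReal.ofReal δ ∂(Measure.pi fun _ : Fin n => F) := by
        refine lintegral_mono_ae ?_
        filter_upwards [hF.ae_pi_mem_support] with x hx
        refine le_trans (le_of_eq ?_) (ENNReal.ofReal_le_ofReal (hδ x hx))
        rw [ENNReal.ofReal_sum_of_nonneg]
        · refine Finset.sum_congr rfl fun g _ => ?_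
          by_cases hg : x ∈ T g <;> simp [hg]
        · intro g _
          have := graphProb_nonneg (fun i j => hF.inner_mem _ (hx i) _ (hx j)) g
          split_ifs
          exacts [this, le_rfl]
    _ = ENNReal.ofReal δ := by simp

theorem measurable_edgeNoise (g : SimpleGraph (Fin n)) (e : Fin n × Fin n) :
    Measurable fun x : Fin n → EuclideanSpace ℝ (Fin d) => edgeNoise x g e :=
  measurable_const.sub ((measurable_pi_apply _).inner (measurable_pi_apply _))

theorem noise_adj_apply {x : Fin n → EuclideanSpace ℝ (Fin d)} {g : SimpleGraph (Fin n)}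
    (i j : Fin n) : noise (adj g) x i j = edgeNoise x g (i, j) := by
  simp [noise, edgeNoise, SimpleGraph.adjMatrix_apply]

theorem noise_adj_comm {x : Fin n → EuclideanSpace ℝ (Fin d)} {g : SimpleGraph (Fin n)}
    (i j : Fin n) : noise (adj g) x i j = noise (adj g) x j i := by
  simp only [noise, Matrix.of_apply, SimpleGraph.adjMatrix_apply]
  rw [real_inner_comm]
  by_cases h : g.Adj i j
  · simp [h, h.symm]
  · have h' : ¬ g.Adj j i := fun k => h k.symm
    simp [h, h']

theorem abs_noise_adj_le {x : Fin n → EuclideanSpace ℝ (Fin d)}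
    (hx : ∀ i j, 0 ≤ inner ℝ (x i) (x j) ∧ inner ℝ (x i) (x j) ≤ 1) {g : SimpleGraph (Fin n)}
    (i j : Fin n) : |noise (adj g) x i j| ≤ 1 := by
  have := hx i j
  simp only [noise, Matrix.of_apply, SimpleGraph.adjMatrix_apply]
  rw [abs_le]
  split_ifs <;> constructor <;> linarith

theorem sum_mul_noise_eq (a : Matrix (Fin n) (Fin n) ℝ) (x : Fin n → EuclideanSpace ℝ (Fin d))
    (g : SimpleGraph (Fin n)) :
    ∑ i, ∑ j, a i j * noise (adj g) x i j =
      ∑ e ∈ pairs n, (a e.1 e.2 + a e.2 e.1) * edgeNoise x g e +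
        ∑ i, a i i * noise (adj g) x i i := by
  rw [sum_sum_eq_sum_pairs fun i j => a i j * noise (adj g) x i j]
  congr 1
  refine Finset.sum_congr rfl fun e _ => ?_
  rw [noise_adj_comm e.2 e.1, noise_adj_apply e.1 e.2]
  ring

/-- Linear statistics of `A - XXᵀ` with weights depending on `X` have sub-Gaussian tails. -/
theorem IsRDPG.measure_lt_sum_mul_noise_le [IsProbabilityMeasure μ] (h : IsRDPG μ F n A X)
    (hF : IsInnerProductDistribution F)
    {a : (Fin n → EuclideanSpace ℝ (Fin d)) → Matrix (Fin n) (Fin n) ℝ}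
    (ha : ∀ i j, Measurable fun x => a x i j) {V τ t : ℝ} (hV : 0 < V) (ht : 0 ≤ t)
    (haV : ∀ x : Fin n → EuclideanSpace ℝ (Fin d), (∀ i, x i ∈ F.support) →
      ∑ i, ∑ j, a x i j ^ 2 ≤ V)
    (haτ : ∀ x : Fin n → EuclideanSpace ℝ (Fin d), (∀ i, x i ∈ F.support) →
      ∑ i, |a x i i| ≤ τ) :
    μ {ω | t + τ < ∑ i, ∑ j, a (X ω) i j * noise (A ω) (X ω) i j} ≤
      ENNReal.ofReal (Real.exp (-t ^ 2 / (8 * V))) := by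
  classical
  -- Each edge enters at (i, j) and at (j, i), so its weight is a_ij + a_ji. The squared weights sum
  -- to at most 2V, whence the 8V in the exponent. The diagonal of the noise is not random given X
  -- and is paid for by τ.
  set w : (Fin n → EuclideanSpace ℝ (Fin d)) → Fin n × Fin n → ℝ :=
    fun x e => a x e.1 e.2 + a x e.2 e.1 with hw
  have hwV (x : Fin n → EuclideanSpace ℝ (Fin d)) (hx : ∀ i, x i ∈ F.support) :
      ∑ e ∈ pairs n, w x e ^ 2 ≤ 2 * V := by
    have h1 := sum_sum_eq_sum_pairs fun i j => a x i j ^ 2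
    have h2 : 0 ≤ ∑ i, a x i i ^ 2 := by positivity
    have h3 : ∑ e ∈ pairs n, w x e ^ 2 ≤
        2 * ∑ e ∈ pairs n, (a x e.1 e.2 ^ 2 + a x e.2 e.1 ^ 2) := by
      rw [Finset.mul_sum]
      exact Finset.sum_le_sum fun e _ => by nlinarith [sq_nonneg (a x e.1 e.2 - a x e.2 e.1)]
    linarith [haV x hx]
  set T : SimpleGraph (Fin n) → Set (Fin n → EuclideanSpace ℝ (Fin d)) :=
    fun g => {x | t ≤ ∑ e ∈ pairs n, w x e * edgeNoise x g e} with hTdef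
  have hT (g) : MeasurableSet (T g) := measurableSet_le measurable_const
    (Finset.measurable_sum _ fun e _ => ((ha _ _).add (ha _ _)).mul (measurable_edgeNoise g e))
  have hmain := h.measure_exists_le hF hT (δ := Real.exp (-t ^ 2 / (8 * V))) fun x hx => by
    have := sum_graphProb_tail_le (fun i j => hF.inner_mem _ (hx i) _ (hx j)) (w x)
      (by linarith : 0 < 2 * V) (hwV x hx) ht
    rw [show 8 * V = 4 * (2 * V) by ring]
    exact this
  refine (measure_mono_ae ?_).trans hmain
  filter_upwards [h.ae_mem_support hF, h.ae_exists_adj hF] with ω hω hg hlt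
  obtain ⟨g, hg⟩ := hg
  refine ⟨g, hg, ?_⟩
  change t ≤ _
  change t + τ < _ at hlt
  rw [hg, sum_mul_noise_eq] at hlt
  have h1 : ∑ i, a (X ω) i i * noise (adj g) (X ω) i i ≤ ∑ i, |a (X ω) i i| :=
    Finset.sum_le_sum fun i _ => (le_abs_self _).trans (by
      rw [abs_mul]
      exact mul_le_of_le_one_right (abs_nonneg _)
        (abs_noise_adj_le (fun i j => hF.inner_mem _ (hω i) _ (hω j)) _ _))
  linarith [haτ _ hω]

theorem IsRDPG.measure_lt_abs_sum_mul_noise_le [IsProbabilityMeasure μ] (h : IsRDPG μ F n A X)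
    (hF : IsInnerProductDistribution F)
    {a : (Fin n → EuclideanSpace ℝ (Fin d)) → Matrix (Fin n) (Fin n) ℝ}
    (ha : ∀ i j, Measurable fun x => a x i j) {V τ t : ℝ} (hV : 0 < V) (ht : 0 ≤ t)
    (haV : ∀ x : Fin n → EuclideanSpace ℝ (Fin d), (∀ i, x i ∈ F.support) →
      ∑ i, ∑ j, a x i j ^ 2 ≤ V)
    (haτ : ∀ x : Fin n → EuclideanSpace ℝ (Fin d), (∀ i, x i ∈ F.support) →
      ∑ i, |a x i i| ≤ τ) :
    μ {ω | t + τ < |∑ i, ∑ j, a (X ω) i j * noise (A ω) (X ω) i j|} ≤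
      ENNReal.ofReal (2 * Real.exp (-t ^ 2 / (8 * V))) := by
  have h1 := h.measure_lt_sum_mul_noise_le hF ha hV ht haV haτ
  have h2 := h.measure_lt_sum_mul_noise_le hF (a := fun x => -a x) (fun i j => (ha i j).neg) hV ht
    (by simpa using haV) (by simpa using haτ)
  rw [two_mul, ENNReal.ofReal_add (Real.exp_pos _).le (Real.exp_pos _).le]
  refine le_trans (measure_mono ?_) ((measure_union_le _ _).trans (add_le_add h1 h2))
  intro ω hω
  rcases lt_abs.1 (Set.mem_ofPred.1 hω) with h' | h'
  · exact Or.inl h'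
  · refine Or.inr ?_
    simpa using h'

end Transfer

/-! ### Boundedness of the support and positivity of the second moment matrix. -/

section SecondMoment

open Matrix

variable {d : ℕ} {F : Measure (EuclideanSpace ℝ (Fin d))}

theorem IsInnerProductDistribution.norm_le_one (hF : IsInnerProductDistribution F)
    {x : EuclideanSpace ℝ (Fin d)} (hx : x ∈ F.support) : ‖x‖ ≤ 1 := by
  have := (hF.inner_mem x hx x hx).2
  rw [real_inner_self_eq_norm_sq] at this
  exact (sq_le_one_iff₀ (norm_nonneg _)).1 this

theorem IsInnerProductDistribution.abs_apply_le_one (hF : IsInnerProductDistribution F)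
    {x : EuclideanSpace ℝ (Fin d)} (hx : x ∈ F.support) (s : Fin d) : |x s| ≤ 1 :=
  (PiLp.norm_apply_le x s).trans (hF.norm_le_one hx)

theorem IsInnerProductDistribution.abs_mul_le_one (hF : IsInnerProductDistribution F)
    {x : EuclideanSpace ℝ (Fin d)} (hx : x ∈ F.support) (s t : Fin d) : |x s * x t| ≤ 1 := by
  rw [abs_mul]
  exact mul_le_one₀ (hF.abs_apply_le_one hx s) (abs_nonneg _) (hF.abs_apply_le_one hx t)

theorem measurable_apply_mul_apply (s t : Fin d) :
    Measurable fun x : EuclideanSpace ℝ (Fin d) => x s * x t := by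
  fun_prop

theorem IsInnerProductDistribution.integrable_mul (hF : IsInnerProductDistribution F)
    (s t : Fin d) : Integrable (fun x : EuclideanSpace ℝ (Fin d) => x s * x t) F := by
  have := hF.isProbabilityMeasure
  refine Integrable.of_bound (measurable_apply_mul_apply s t).aestronglyMeasurable 1 ?_
  filter_upwards [Measure.support_mem_ae] with x hx using hF.abs_mul_le_one hx s t

theorem IsInnerProductDistribution.exists_pos_mul_le (hF : IsInnerProductDistribution F)
    (hΔ : (secondMoment F).rank = d) :
    ∃ c > 0, ∀ u : Fin d → ℝ, c * (u ⬝ᵥ u) ≤ u ⬝ᵥ (secondMoment F *ᵥ u) := by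
  have hH : (secondMoment F).IsHermitian := by
    ext s t
    simp [secondMoment, mul_comm]
  have hP : (secondMoment F).PosSemidef := by
    refine Matrix.PosSemidef.of_dotProduct_mulVec_nonneg hH fun u => ?_
    have h1 : star u ⬝ᵥ (secondMoment F *ᵥ u) = ∫ x, (∑ s, u s * x s) ^ 2 ∂F := by
      have h2 (x : EuclideanSpace ℝ (Fin d)) : (∑ s, u s * x s) ^ 2 =
          ∑ s, ∑ t, (u s * u t) * (x s * x t) := by
        rw [sq, Finset.sum_mul_sum]
        exact Finset.sum_congr rfl fun s _ => Finset.sum_congr rfl fun t _ => by ring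
      simp_rw [h2]
      rw [integral_finsetSum _ fun s _ => integrable_finsetSum _ fun t _ =>
        (hF.integrable_mul s t).const_mul _]
      refine Finset.sum_congr rfl fun s _ => ?_
      rw [integral_finsetSum _ fun t _ => (hF.integrable_mul s t).const_mul _]
      simp_rw [integral_const_mul]
      simp only [mulVec, dotProduct, secondMoment, of_apply, Finset.mul_sum]
      exact Finset.sum_congr rfl fun t _ => by simp; ring
    rw [h1]
    exact integral_nonneg fun x => sq_nonneg _
  have hpos (i) : 0 < hH.eigenvalues i := by
    have h1 := hH.rank_eq_card_non_zero_eigs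
    rw [hΔ] at h1
    refine (hP.eigenvalues_nonneg i).lt_of_ne' fun h0 => ?_
    have h2 := Fintype.card_subtype_lt (p := fun i => hH.eigenvalues i ≠ 0) (x := i) (by simpa)
    rw [← h1, Fintype.card_fin] at h2
    exact lt_irrefl _ h2
  -- A positive lower bound for all eigenvalues that also makes sense for d = 0, where there is no
  -- smallest one.
  set c : ℝ := (1 + ∑ i, (hH.eigenvalues i)⁻¹)⁻¹ with hc
  have hS : 0 ≤ ∑ i, (hH.eigenvalues i)⁻¹ := Finset.sum_nonneg fun i _ => (inv_pos.2 (hpos i)).le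
  have hci (i) : c ≤ hH.eigenvalues i := by
    rw [hc]
    refine inv_le_of_inv_le₀ (hpos i) ?_
    have := Finset.single_le_sum (f := fun i => (hH.eigenvalues i)⁻¹)
      (fun i _ => (inv_pos.2 (hpos i)).le) (Finset.mem_univ i)
    linarith
  refine ⟨c, by positivity, fun u => ?_⟩
  set V := hH.eigenvectorUnitary.1
  have hV2 : V * Vᵀ = 1 := (Matrix.mem_orthogonalGroup_iff _ ℝ).1 hH.eigenvectorUnitary.2
  have hspec : secondMoment F = V * diagonal hH.eigenvalues * Vᵀ := by
    have := hH.spectral_theorem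
    rw [Unitary.conjStarAlgAut_apply] at this
    exact this
  have h1 : u ⬝ᵥ (secondMoment F *ᵥ u) =
      (Vᵀ *ᵥ u) ⬝ᵥ (diagonal hH.eigenvalues *ᵥ (Vᵀ *ᵥ u)) := by
    conv_lhs => rw [hspec]
    rw [Matrix.mul_assoc, ← mulVec_mulVec, dotProduct_mulVec_transpose, mulVec_mulVec]
  have h2 : u ⬝ᵥ u = (Vᵀ *ᵥ u) ⬝ᵥ (Vᵀ *ᵥ u) := by
    rw [← dotProduct_mulVec_transpose, mulVec_mulVec, hV2, one_mulVec]
  rw [h1, h2]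
  simp only [dotProduct, mulVec_diagonal, Finset.mul_sum]
  refine Finset.sum_le_sum fun i _ => ?_
  nlinarith [hci i, mul_self_nonneg ((Vᵀ *ᵥ u) i),
    mul_le_mul_of_nonneg_right (hci i) (mul_self_nonneg ((Vᵀ *ᵥ u) i))]

end SecondMoment

/-! ### Borel–Cantelli and growth of the Gram matrix. -/

section AlmostSure

open Matrix
open scoped Matrix.Norms.L2Operator

theorem ae_eventually_notMem_of_le_ofReal {Ω : Type*} [MeasurableSpace Ω] {μ : Measure Ω}
    {s : ℕ → Set Ω} {f : ℕ → ℝ} (hf : Summable f)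
    (h : ∀ᶠ n in atTop, μ (s n) ≤ ENNReal.ofReal (f n)) : ∀ᵐ ω ∂μ, ∀ᶠ n in atTop, ω ∉ s n := by
  obtain ⟨N, hN⟩ := eventually_atTop.1 h
  have h1 : ∑' k, μ (s (k + N)) ≠ ∞ :=
    ne_top_of_le_ne_top ((summable_nat_add_iff N).2 hf).tsum_ofReal_ne_top
      (ENNReal.tsum_le_tsum fun k => hN _ (Nat.le_add_left N k))
  filter_upwards [ae_eventually_notMem h1] with ω hω
  exact (eventually_map (m := fun k => k + N)).2 hω |> fun h => by rwa [map_add_atTop_eq_nat] at h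

variable {d : ℕ} {F : Measure (EuclideanSpace ℝ (Fin d))}
  {Ω : Type*} [MeasurableSpace Ω] {μ : Measure Ω}
  {A : (n : ℕ) → Ω → Matrix (Fin n) (Fin n) ℝ}
  {X : (n : ℕ) → Ω → Fin n → EuclideanSpace ℝ (Fin d)}

/-- Hoeffding's inequality for bounded functions of the latent positions. -/
theorem IsRDPG.measure_sum_sub_integral_ge_le {n : ℕ} {A : Ω → Matrix (Fin n) (Fin n) ℝ}
    {X : Ω → Fin n → EuclideanSpace ℝ (Fin d)} (h : IsRDPG μ F n A X)
    (hF : IsInnerProductDistribution F) {f : EuclideanSpace ℝ (Fin d) → ℝ} (hf : Measurable f)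
    (hf1 : ∀ x ∈ F.support, |f x| ≤ 1) {t : ℝ} (ht : 0 ≤ t) :
    μ {ω | t ≤ ∑ i, f (X ω i) - n * ∫ x, f x ∂F} ≤
      ENNReal.ofReal (Real.exp (-t ^ 2 / (2 * n))) := by
  have := hF.isProbabilityMeasure
  have hs : MeasurableSet {x : Fin n → EuclideanSpace ℝ (Fin d) |
      t ≤ ∑ i, (f (x i) - ∫ y, f y ∂F)} := by
    refine measurableSet_le measurable_const (Finset.measurable_sum _ fun i _ => ?_)
    exact (hf.comp (measurable_pi_apply i)).sub measurable_const
  have h1 : μ {ω | t ≤ ∑ i, f (X ω i) - n * ∫ x, f x ∂F} =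
      (Measure.pi fun _ : Fin n => F) {x | t ≤ ∑ i, (f (x i) - ∫ y, f y ∂F)} := by
    rw [← h.law_X, Measure.map_apply h.measurable_X hs]
    congr 1
    ext ω
    simp [Finset.sum_sub_distrib]
  have hsub (i : Fin n) : HasSubgaussianMGF
      (fun x : Fin n → EuclideanSpace ℝ (Fin d) => f (x i) - ∫ y, f y ∂F) 1
      (Measure.pi fun _ : Fin n => F) := by
    have h2 := hasSubgaussianMGF_of_mem_Icc (μ := F) (X := f) (a := -1) (b := 1) hf.aemeasurable (by
      filter_upwards [Measure.support_mem_ae] with x hx using abs_le.1 (hf1 x hx))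
    have h3 : ((‖(1 : ℝ) - -1‖₊ / 2) ^ 2 : NNReal) = 1 := by
      rw [← NNReal.coe_inj]
      norm_num
    rw [h3] at h2
    refine HasSubgaussianMGF.of_map (X := fun y : EuclideanSpace ℝ (Fin d) => f y - ∫ y, f y ∂F)
      (Y := fun x : Fin n → EuclideanSpace ℝ (Fin d) => x i)
      (measurable_pi_apply i).aemeasurable ?_
    have h4 : Measure.map (fun x : Fin n → EuclideanSpace ℝ (Fin d) => x i)
        (Measure.pi fun _ : Fin n => F) = F := (measurePreserving_eval (fun _ : Fin n => F) i).map_eq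
    rwa [h4]
  have hind : iIndepFun (fun i (x : Fin n → EuclideanSpace ℝ (Fin d)) => f (x i) - ∫ y, f y ∂F)
      (Measure.pi fun _ : Fin n => F) :=
    iIndepFun_pi (X := fun _ x => f x - ∫ y, f y ∂F) fun _ => (hf.sub measurable_const).aemeasurable
  have h5 := HasSubgaussianMGF.measure_sum_ge_le_of_iIndepFun hind
    (s := Finset.univ) (fun i _ => hsub i) ht
  rw [h1, ← ofReal_measureReal]
  refine ENNReal.ofReal_le_ofReal ?_
  simpa using h5

theorem summable_exp_neg_mul_nat {a : ℝ} (ha : 0 < a) :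
    Summable fun n : ℕ => Real.exp (-a * n) := by
  simpa [mul_comm] using Real.summable_exp_nat_mul_iff.2 (neg_lt_zero.2 ha)

/-- The latent positions for different n are coupled arbitrarily and need not extend one another, so
the strong law for a single sequence does not apply. Summable Hoeffding bounds replace it. -/
theorem ae_eventually_abs_sum_sub_lt (hF : IsInnerProductDistribution F)
    (hAX : ∀ n, IsRDPG μ F n (A n) (X n)) {f : EuclideanSpace ℝ (Fin d) → ℝ} (hf : Measurable f)
    (hf1 : ∀ x ∈ F.support, |f x| ≤ 1) {δ : ℝ} (hδ : 0 < δ) :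
    ∀ᵐ ω ∂μ, ∀ᶠ n : ℕ in atTop, |∑ i, f (X n ω i) - n * ∫ x, f x ∂F| < δ * n := by
  have key (f : EuclideanSpace ℝ (Fin d) → ℝ) (hf : Measurable f)
      (hf1 : ∀ x ∈ F.support, |f x| ≤ 1) :
      ∀ᵐ ω ∂μ, ∀ᶠ n : ℕ in atTop, ∑ i, f (X n ω i) - n * ∫ x, f x ∂F < δ * n := by
    have := ae_eventually_notMem_of_le_ofReal (μ := μ)
      (s := fun n => {ω | δ * n ≤ ∑ i, f (X n ω i) - n * ∫ x, f x ∂F})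
      (summable_exp_neg_mul_nat (a := δ ^ 2 / 2) (by positivity)) (by
        filter_upwards [eventually_gt_atTop 0] with n hn
        refine ((hAX n).measure_sum_sub_integral_ge_le hF hf hf1 (by positivity)).trans_eq ?_
        congr 2
        field_simp)
    filter_upwards [this] with ω hω
    filter_upwards [hω] with n hn using not_le.1 hn
  filter_upwards [key f hf hf1, key (fun x => -f x) hf.neg (by simpa using hf1)] with ω h1 h2
  filter_upwards [h1, h2] with n h1 h2
  rw [integral_neg, Finset.sum_neg_distrib] at h2
  exact abs_lt.2 ⟨by linarith, h1⟩

/-- The matrix whose rows are the given vectors. -/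
def rowMatrix {n : ℕ} (x : Fin n → EuclideanSpace ℝ (Fin d)) : Matrix (Fin n) (Fin d) ℝ :=
  Matrix.of fun i s => x i s

theorem exists_ae_eventually_gram_lower_bound (hF : IsInnerProductDistribution F)
    (hΔ : (secondMoment F).rank = d) (hAX : ∀ n, IsRDPG μ F n (A n) (X n)) :
    ∃ c > 0, ∀ᵐ ω ∂μ, ∀ᶠ n : ℕ in atTop, ∀ u : Fin d → ℝ,
      c * n * (u ⬝ᵥ u) ≤ (rowMatrix (X n ω) *ᵥ u) ⬝ᵥ (rowMatrix (X n ω) *ᵥ u) := by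
  obtain ⟨c, hc, hcΔ⟩ := hF.exists_pos_mul_le hΔ
  refine ⟨c / 2, by positivity, ?_⟩
  -- Entrywise deviations below δn change the quadratic form by at most δnd‖u‖², which is at most
  -- half of cn‖u‖². The 1 keeps the denominator positive for d = 0.
  set δ : ℝ := c / (2 * (d + 1)) with hδ
  have hδ0 : 0 < δ := by positivity
  have h1 : ∀ᵐ ω ∂μ, ∀ s t : Fin d, ∀ᶠ n : ℕ in atTop,
      |∑ i, X n ω i s * X n ω i t - n * secondMoment F s t| < δ * n := by
    rw [ae_all_iff]; intro s; rw [ae_all_iff]; intro t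
    exact ae_eventually_abs_sum_sub_lt hF hAX (measurable_apply_mul_apply s t)
      (fun x hx => hF.abs_mul_le_one hx s t) hδ0
  filter_upwards [h1] with ω hω
  have h2 : ∀ᶠ n : ℕ in atTop, ∀ s t : Fin d,
      |∑ i, X n ω i s * X n ω i t - n * secondMoment F s t| < δ * n :=
    eventually_all.2 fun s => eventually_all.2 fun t => hω s t
  filter_upwards [h2] with n hn u
  set M : Matrix (Fin d) (Fin d) ℝ := (rowMatrix (X n ω))ᵀ * rowMatrix (X n ω) with hM
  have hMst (s t) : M s t = ∑ i, X n ω i s * X n ω i t := rfl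
  have h3 : (rowMatrix (X n ω) *ᵥ u) ⬝ᵥ (rowMatrix (X n ω) *ᵥ u) = u ⬝ᵥ (M *ᵥ u) := by
    rw [hM, ← mulVec_mulVec, dotProduct_mulVec_transpose, dotProduct_comm]
  have h4 : |u ⬝ᵥ ((M - (n : ℝ) • secondMoment F) *ᵥ u)| ≤ δ * n * (d * (u ⬝ᵥ u)) := by
    simp only [dotProduct, mulVec, Finset.mul_sum]
    calc _ ≤ ∑ s, ∑ t, δ * n * (|u s| * |u t|) := by
          refine (Finset.abs_sum_le_sum_abs _ _).trans (Finset.sum_le_sum fun s _ => ?_)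
          refine (Finset.abs_sum_le_sum_abs _ _).trans (Finset.sum_le_sum fun t _ => ?_)
          rw [abs_mul, abs_mul, mul_left_comm]
          gcongr
          rw [Matrix.sub_apply, Matrix.smul_apply, smul_eq_mul, hMst]
          exact (hn s t).le
      _ = δ * n * (∑ s, |u s|) ^ 2 := by
          rw [sq, Finset.sum_mul_sum, Finset.mul_sum]
          exact Finset.sum_congr rfl fun s _ => by rw [Finset.mul_sum]
      _ ≤ δ * n * (d * ∑ s, u s * u s) := by
          gcongr
          have := sq_sum_le_card_mul_sum_sq (s := Finset.univ) (f := fun s => |u s|)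
          simpa [sq] using this
      _ = _ := by simp only [Finset.mul_sum]
  have h5 : u ⬝ᵥ (M *ᵥ u) = u ⬝ᵥ ((M - (n : ℝ) • secondMoment F) *ᵥ u) +
      n * (u ⬝ᵥ (secondMoment F *ᵥ u)) := by
    rw [sub_mulVec, dotProduct_sub, smul_mulVec, dotProduct_smul, smul_eq_mul]
    ring
  have huu := dotProduct_self_nonneg u
  have h6 : δ * n * (d * (u ⬝ᵥ u)) ≤ c / 2 * n * (u ⬝ᵥ u) := by
    have : δ * d ≤ c / 2 := by
      rw [hδ, div_mul_eq_mul_div, div_le_div_iff₀ (by positivity) (by positivity)]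
      nlinarith
    calc _ = (δ * d) * (n * (u ⬝ᵥ u)) := by ring
      _ ≤ c / 2 * (n * (u ⬝ᵥ u)) := by gcongr
      _ = _ := by ring
  have h7 : n * (c * (u ⬝ᵥ u)) ≤ n * (u ⬝ᵥ (secondMoment F *ᵥ u)) := by gcongr; exact hcΔ u
  rw [h3, h5]
  linarith [(abs_le.1 h4).1]

end AlmostSure

/-! ### Almost sure bounds on the noise matrix. -/

section NoiseBounds

open Matrix
open scoped Matrix.Norms.L2Operator

variable {d : ℕ} {F : Measure (EuclideanSpace ℝ (Fin d))}
  {Ω : Type*} [MeasurableSpace Ω] {μ : Measure Ω} [IsProbabilityMeasure μ]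
  {A : (n : ℕ) → Ω → Matrix (Fin n) (Fin n) ℝ}
  {X : (n : ℕ) → Ω → Fin n → EuclideanSpace ℝ (Fin d)}

theorem dotProduct_mulVec_eq_sum_sum {ι : Type*} [Fintype ι] (M : Matrix ι ι ℝ) (u v : ι → ℝ) :
    u ⬝ᵥ (M *ᵥ v) = ∑ i, ∑ j, (u i * v j) * M i j := by
  simp only [dotProduct, mulVec, Finset.mul_sum]
  exact Finset.sum_congr rfl fun i _ => Finset.sum_congr rfl fun j _ => by ring

theorem exp_neg_mul_log_nat {n : ℕ} (hn : 0 < n) (k : ℕ) :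
    Real.exp (-(k * Real.log n)) = ((n : ℝ) ^ k)⁻¹ := by
  rw [Real.exp_neg, Real.exp_nat_mul, Real.exp_log (by exact_mod_cast hn)]

theorem eventually_one_le_log : ∀ᶠ n : ℕ in atTop, 1 ≤ Real.log n :=
  (Real.tendsto_log_atTop.comp tendsto_natCast_atTop_atTop).eventually_ge_atTop 1

theorem IsRDPG.measure_lt_abs_bilinear_le {n : ℕ} {A : Ω → Matrix (Fin n) (Fin n) ℝ}
    {X : Ω → Fin n → EuclideanSpace ℝ (Fin d)} (h : IsRDPG μ F n A X)
    (hF : IsInnerProductDistribution F)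
    {u v : (Fin n → EuclideanSpace ℝ (Fin d)) → Fin n → ℝ}
    (hu : ∀ i, Measurable fun x => u x i) (hv : ∀ i, Measurable fun x => v x i)
    {V τ t : ℝ} (hV : 0 < V) (ht : 0 ≤ t)
    (huv : ∀ x : Fin n → EuclideanSpace ℝ (Fin d), (∀ i, x i ∈ F.support) →
      (∑ i, u x i ^ 2) * ∑ i, v x i ^ 2 ≤ V)
    (huvτ : ∀ x : Fin n → EuclideanSpace ℝ (Fin d), (∀ i, x i ∈ F.support) →
      ∑ i, |u x i * v x i| ≤ τ) :
    μ {ω | t + τ < |u (X ω) ⬝ᵥ (noise (A ω) (X ω) *ᵥ v (X ω))|} ≤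
      ENNReal.ofReal (2 * Real.exp (-t ^ 2 / (8 * V))) := by
  have := h.measure_lt_abs_sum_mul_noise_le hF
    (a := fun x => Matrix.of fun i j => u x i * v x j) (fun i j => (hu i).mul (hv j)) hV ht
    (fun x hx => by
      refine le_trans (le_of_eq ?_) (huv x hx)
      rw [Finset.sum_mul_sum]
      simp only [of_apply, mul_pow]) huvτ
  simpa only [dotProduct_mulVec_eq_sum_sum, of_apply] using this

/-- The vectors may depend on the latent positions but not on the edges; this later admits the
gradient of the U-statistic as u. -/
theorem ae_eventually_abs_bilinear_le (hF : IsInnerProductDistribution F)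
    (hAX : ∀ n, IsRDPG μ F n (A n) (X n))
    {u v : (n : ℕ) → (Fin n → EuclideanSpace ℝ (Fin d)) → Fin n → ℝ}
    (hu : ∀ n i, Measurable fun x => u n x i) (hv : ∀ n i, Measurable fun x => v n x i)
    {K : ℝ} (hK : 0 < K)
    (hu1 : ∀ᶠ n in atTop, ∀ x : Fin n → EuclideanSpace ℝ (Fin d), (∀ i, x i ∈ F.support) →
      ∀ i, |u n x i| ≤ K)
    (hv1 : ∀ᶠ n in atTop, ∀ x : Fin n → EuclideanSpace ℝ (Fin d), (∀ i, x i ∈ F.support) →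
      ∀ i, |v n x i| ≤ K) :
    ∀ᵐ ω ∂μ, ∀ᶠ n : ℕ in atTop,
      |u n (X n ω) ⬝ᵥ (noise (A n ω) (X n ω) *ᵥ v n (X n ω))| ≤
        5 * K ^ 2 * (n * √(Real.log n)) := by
  have hsum : Summable fun n : ℕ => 2 * ((n : ℝ) ^ 2)⁻¹ :=
    (Real.summable_nat_pow_inv.2 one_lt_two).mul_left 2
  have h1 := ae_eventually_notMem_of_le_ofReal (μ := μ)
    (s := fun n => {ω | 4 * K ^ 2 * (n * √(Real.log n)) + K ^ 2 * n <
      |u n (X n ω) ⬝ᵥ (noise (A n ω) (X n ω) *ᵥ v n (X n ω))|}) hsum (by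
    filter_upwards [hu1, hv1, eventually_gt_atTop 0] with n hu1 hv1 hn
    have hn' : (0 : ℝ) < n := by exact_mod_cast hn
    have hlog : 0 ≤ Real.log n := Real.log_natCast_nonneg n
    -- With t = 4K²n√log n and V = (K²n)² the exponent is -2 log n, so the tail 2n⁻² is summable.
    -- The diagonal costs K²n, which turns the factor 4 into 5.
    refine ((hAX n).measure_lt_abs_bilinear_le hF (hu n) (hv n)
      (V := (K ^ 2 * n) ^ 2) (τ := K ^ 2 * n) (by positivity) (by positivity) ?_ ?_).trans ?_
    · intro x hx
      have h2 (w : Fin n → ℝ) (hw : ∀ i, |w i| ≤ K) : ∑ i, w i ^ 2 ≤ K ^ 2 * n := by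
        calc _ ≤ ∑ _i : Fin n, K ^ 2 :=
              Finset.sum_le_sum fun i _ => sq_le_sq.2 ((hw i).trans (le_abs_self K))
          _ = _ := by simp [mul_comm]
      rw [sq (K ^ 2 * (n : ℝ))]
      gcongr
      exacts [h2 _ (hu1 x hx), h2 _ (hv1 x hx)]
    · intro x hx
      calc _ ≤ ∑ _i : Fin n, K ^ 2 := Finset.sum_le_sum fun i _ => by
              rw [abs_mul, sq]
              gcongr
              exacts [hu1 x hx i, hv1 x hx i]
        _ = _ := by simp [mul_comm]
    · refine ENNReal.ofReal_le_ofReal (le_of_eq ?_)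
      rw [← exp_neg_mul_log_nat hn]
      congr 2
      rw [mul_pow, mul_pow, mul_pow, Real.sq_sqrt hlog]
      field_simp
      push_cast
      ring)
  filter_upwards [h1] with ω hω
  filter_upwards [hω, eventually_one_le_log] with n hn hlog
  refine (not_lt.1 hn).trans ?_
  have : 1 ≤ √(Real.log n) := Real.one_le_sqrt.2 hlog
  have h3 : K ^ 2 * n * 1 ≤ K ^ 2 * n * √(Real.log n) := by gcongr
  nlinarith

theorem measurable_apply_apply {n : ℕ} (i : Fin n) (s : Fin d) :
    Measurable fun x : Fin n → EuclideanSpace ℝ (Fin d) => x i s := by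
  fun_prop

theorem ae_eventually_abs_noise_mul_le (hF : IsInnerProductDistribution F)
    (hAX : ∀ n, IsRDPG μ F n (A n) (X n)) :
    ∀ᵐ ω ∂μ, ∀ᶠ n : ℕ in atTop, ∀ i s,
      |(noise (A n ω) (X n ω) * rowMatrix (X n ω)) i s| ≤ 6 * (√n * √(Real.log n)) := by
  have hsum : Summable fun n : ℕ => d * (2 * ((n : ℝ) ^ 2)⁻¹) :=
    ((Real.summable_nat_pow_inv.2 one_lt_two).mul_left 2).mul_left _
  have h1 := ae_eventually_notMem_of_le_ofReal (μ := μ)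
    (s := fun n => ⋃ i : Fin n, ⋃ s : Fin d, {ω | 5 * (√n * √(Real.log n)) + 1 <
      |(Pi.single i 1 : Fin n → ℝ) ⬝ᵥ
        (noise (A n ω) (X n ω) *ᵥ fun j => X n ω j s)|}) hsum (by
    filter_upwards [eventually_gt_atTop 0] with n hn
    have hn' : (0 : ℝ) < n := by exact_mod_cast hn
    have hlog : 0 ≤ Real.log n := Real.log_natCast_nonneg n
    have h2 (i : Fin n) (s : Fin d) : μ {ω | 5 * (√n * √(Real.log n)) + 1 <
        |(Pi.single i 1 : Fin n → ℝ) ⬝ᵥ (noise (A n ω) (X n ω) *ᵥ fun j => X n ω j s)|} ≤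
        ENNReal.ofReal (2 * ((n : ℝ) ^ 3)⁻¹) := by
      -- The factor 5 gives the exponent (25/8) log n ≥ 3 log n, so a union over the nd entries
      -- still leaves a multiple of n⁻².
      refine ((hAX n).measure_lt_abs_bilinear_le hF (u := fun _ => Pi.single i 1)
        (v := fun x j => x j s) (V := n) (fun _ => measurable_const)
        (fun j => measurable_apply_apply j s) hn' (by positivity) ?_ ?_).trans ?_
      · intro x hx
        have h3 : ∑ j, (Pi.single i 1 : Fin n → ℝ) j ^ 2 = 1 := by
          rw [Finset.sum_eq_single i] <;> simp +contextual
        rw [h3, one_mul]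
        calc _ ≤ ∑ _j : Fin n, (1 : ℝ) := Finset.sum_le_sum fun j _ =>
              (sq_le_one_iff_abs_le_one _).2 (hF.abs_apply_le_one (hx j) s)
          _ = _ := by simp
      · intro x hx
        rw [Finset.sum_eq_single i]
        · simpa using hF.abs_apply_le_one (hx i) s
        · intro j _ hj
          simp [hj]
        · simp
      · refine ENNReal.ofReal_le_ofReal ?_
        rw [← exp_neg_mul_log_nat hn]
        gcongr
        rw [mul_pow, mul_pow, Real.sq_sqrt hlog, Real.sq_sqrt hn'.le,
          div_le_iff₀ (by positivity)]
        push_cast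
        nlinarith [mul_nonneg hn'.le hlog]
    calc _ ≤ ∑ i : Fin n, ∑ s : Fin d, ENNReal.ofReal (2 * ((n : ℝ) ^ 3)⁻¹) :=
          (measure_iUnion_fintype_le _ _).trans (Finset.sum_le_sum fun i _ =>
            (measure_iUnion_fintype_le _ _).trans (Finset.sum_le_sum fun s _ => h2 i s))
      _ = ENNReal.ofReal (∑ i : Fin n, ∑ s : Fin d, 2 * ((n : ℝ) ^ 3)⁻¹) := by
          rw [ENNReal.ofReal_sum_of_nonneg fun i _ => by positivity]
          refine Finset.sum_congr rfl fun i _ => ?_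
          rw [ENNReal.ofReal_sum_of_nonneg fun i _ => by positivity]
      _ = _ := by
          congr 1
          simp
          field_simp)
  filter_upwards [h1] with ω hω
  filter_upwards [hω, eventually_one_le_log, eventually_ge_atTop 1] with n hn hlog hn1 i s
  have h3 : |(Pi.single i 1 : Fin n → ℝ) ⬝ᵥ (noise (A n ω) (X n ω) *ᵥ fun j => X n ω j s)| ≤
      5 * (√n * √(Real.log n)) + 1 :=
    not_lt.1 fun hlt => hn (Set.mem_iUnion.2 ⟨i, Set.mem_iUnion.2 ⟨s, hlt⟩⟩)
  rw [single_one_dotProduct] at h3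
  refine h3.trans ?_
  have h4 : 1 ≤ √(Real.log n) := Real.one_le_sqrt.2 hlog
  have h5 : (1 : ℝ) ≤ √n := Real.one_le_sqrt.2 (by exact_mod_cast hn1)
  nlinarith

theorem four_mul_exp_neg_two_lt_one : 4 * Real.exp (-2) < 1 := by
  have h1 : (2.5 : ℝ) ≤ Real.exp 1 := by linarith [Real.exp_one_gt_d9]
  have h2 : Real.exp 2 = Real.exp 1 * Real.exp 1 := by rw [← Real.exp_add]; norm_num
  rw [Real.exp_neg, ← div_eq_mul_inv, div_lt_one (Real.exp_pos _), h2]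
  nlinarith

theorem ae_eventually_signVector_noise_le (hF : IsInnerProductDistribution F)
    (hAX : ∀ n, IsRDPG μ F n (A n) (X n)) :
    ∀ᵐ ω ∂μ, ∀ᶠ n : ℕ in atTop, ∀ s t : Fin n → Bool,
      signVector s ⬝ᵥ (noise (A n ω) (X n ω) *ᵥ signVector t) ≤ 5 * (n * √n) := by
  have hsum : Summable fun n : ℕ => 2 * (4 * Real.exp (-2)) ^ n :=
    (summable_geometric_of_lt_one (by positivity) four_mul_exp_neg_two_lt_one).mul_left 2
  have h1 := ae_eventually_notMem_of_le_ofReal (μ := μ)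
    (s := fun n => ⋃ s : Fin n → Bool, ⋃ t : Fin n → Bool, {ω | 4 * (n * √n) + n <
      |signVector s ⬝ᵥ (noise (A n ω) (X n ω) *ᵥ signVector t)|}) hsum (by
    filter_upwards [eventually_gt_atTop 0] with n hn
    have hn' : (0 : ℝ) < n := by exact_mod_cast hn
    have h2 (s t : Fin n → Bool) : μ {ω | 4 * (n * √n) + n <
        |signVector s ⬝ᵥ (noise (A n ω) (X n ω) *ᵥ signVector t)|} ≤
        ENNReal.ofReal (2 * Real.exp (-2) ^ n) := by
      -- With t = 4n√n and V = n² each tail is 2e^(-2n), which beats the 4ⁿ pairs of sign vectors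
      -- because 4 < e².
      refine ((hAX n).measure_lt_abs_bilinear_le hF (u := fun _ => signVector s)
        (v := fun _ => signVector t) (V := n * n) (fun _ => measurable_const)
        (fun _ => measurable_const) (by positivity) (by positivity) ?_ ?_).trans ?_
      · intro x hx
        have h3 (s : Fin n → Bool) : ∑ j, signVector s j ^ 2 = n := by
          simp_rw [← sq_abs (signVector s _), abs_signVector]
          simp
        rw [h3, h3]
      · intro x hx
        simp_rw [abs_mul, abs_signVector]
        simp
      · refine ENNReal.ofReal_le_ofReal (le_of_eq ?_)
        rw [← Real.exp_nat_mul]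
        congr 2
        rw [mul_pow, mul_pow, Real.sq_sqrt hn'.le]
        field_simp
        norm_num
    calc _ ≤ ∑ s : Fin n → Bool, ∑ t : Fin n → Bool, ENNReal.ofReal (2 * Real.exp (-2) ^ n) :=
          (measure_iUnion_fintype_le _ _).trans (Finset.sum_le_sum fun i _ =>
            (measure_iUnion_fintype_le _ _).trans (Finset.sum_le_sum fun s _ => h2 i s))
      _ = ENNReal.ofReal (∑ s : Fin n → Bool, ∑ t : Fin n → Bool, 2 * Real.exp (-2) ^ n) := by
          rw [ENNReal.ofReal_sum_of_nonneg fun i _ => by positivity]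
          refine Finset.sum_congr rfl fun i _ => ?_
          rw [ENNReal.ofReal_sum_of_nonneg fun i _ => by positivity]
      _ = _ := by
          congr 1
          simp only [Finset.sum_const, Finset.card_univ, Fintype.card_fun, Fintype.card_bool,
            Fintype.card_fin, nsmul_eq_mul]
          rw [mul_pow, show (4 : ℝ) = 2 * 2 by norm_num, mul_pow]
          push_cast
          ring)
  filter_upwards [h1] with ω hω
  filter_upwards [hω, eventually_ge_atTop 1] with n hn hn1 s t
  have h2 : |signVector s ⬝ᵥ (noise (A n ω) (X n ω) *ᵥ signVector t)| ≤ 4 * (n * √n) + n :=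
    not_lt.1 fun hlt => hn (Set.mem_iUnion.2 ⟨s, Set.mem_iUnion.2 ⟨t, hlt⟩⟩)
  refine (le_abs_self _).trans (h2.trans ?_)
  have h5 : (1 : ℝ) ≤ √n := Real.one_le_sqrt.2 (by exact_mod_cast hn1)
  have h6 : (n : ℝ) * 1 ≤ n * √n := by gcongr
  linarith

/-- The fourth-power bound gives ‖E‖⁴ ≤ 5n^(7/2), hence the exponent 7/8. All that is needed later
is that this times √log n is o(n). -/
theorem ae_eventually_norm_noise_le (hF : IsInnerProductDistribution F)
    (hAX : ∀ n, IsRDPG μ F n (A n) (X n)) :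
    ∀ᵐ ω ∂μ, ∀ᶠ n : ℕ in atTop,
      (noise (A n ω) (X n ω))ᵀ = noise (A n ω) (X n ω) ∧
      ‖noise (A n ω) (X n ω)‖ ≤ 2 * (n : ℝ) ^ (7 / 8 : ℝ) := by
  have h2 : ∀ᵐ ω ∂μ, ∀ n, ∀ i, X n ω i ∈ F.support := ae_all_iff.2 fun n => (hAX n).ae_mem_support hF
  have h3 : ∀ᵐ ω ∂μ, ∀ n, ∃ g, A n ω = adj g := ae_all_iff.2 fun n => (hAX n).ae_exists_adj hF
  filter_upwards [ae_eventually_signVector_noise_le hF hAX, h2, h3] with ω h1 h2 h3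
  filter_upwards [h1, eventually_gt_atTop 0] with n h1 hn
  obtain ⟨g, hg⟩ := h3 n
  have hn' : (0 : ℝ) < n := by exact_mod_cast hn
  have hT : (noise (A n ω) (X n ω))ᵀ = noise (A n ω) (X n ω) := by
    ext i j
    rw [transpose_apply, hg, noise_adj_comm]
  refine ⟨hT, ?_⟩
  have h4 := l2_opNorm_pow_four_le hT (fun i j => by
    rw [hg]
    exact abs_noise_adj_le (fun i j => hF.inner_mem _ (h2 n i) _ (h2 n j)) i j) h1
  refine le_of_pow_le_pow_left₀ four_ne_zero (by positivity) (h4.trans ?_)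
  have h5 : ((n : ℝ) ^ (7 / 8 : ℝ)) ^ 4 = n ^ 2 * (n * √n) := by
    rw [← Real.rpow_natCast, ← Real.rpow_mul hn'.le, Real.sqrt_eq_rpow]
    rw [show ((7 / 8 : ℝ) * ((4 : ℕ) : ℝ)) = 2 + (1 + 1 / 2) by norm_num, Real.rpow_add hn',
      Real.rpow_add hn', Real.rpow_one]
    norm_cast
  rw [mul_pow, h5, Fintype.card_fin]
  have : 0 ≤ (n : ℝ) ^ 2 * (n * √n) := by positivity
  nlinarith

end NoiseBounds

/-! ### Expansion of the embedding for the random graph. -/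

section EmbeddingError

open Matrix
open scoped Matrix.Norms.L2Operator

/-- The rate at which the spectral embedding approximates the latent positions. -/
def rate (n : ℕ) : ℝ := (n : ℝ) ^ (7 / 8 : ℝ) * √(Real.log n) / n + Real.log n / √n

theorem tendsto_rate : Tendsto rate atTop (𝓝 0) := by
  have h1 (p : ℝ) (hp : 0 < p) : Tendsto (fun n : ℕ => Real.log n / (n : ℝ) ^ p) atTop (𝓝 0) :=
    (isLittleO_log_rpow_atTop hp).tendsto_div_nhds_zero.comp tendsto_natCast_atTop_atTop
  have h2 : Tendsto (fun n : ℕ => √(Real.log n / (n : ℝ) ^ (1 / 4 : ℝ)) +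
      Real.log n / (n : ℝ) ^ (1 / 2 : ℝ)) atTop (𝓝 0) := by
    simpa using ((h1 (1 / 4) (by norm_num)).sqrt).add (h1 (1 / 2) (by norm_num))
  refine h2.congr' ?_
  filter_upwards [eventually_gt_atTop 0] with n hn
  have hn' : (0 : ℝ) < n := by exact_mod_cast hn
  rw [rate, ← Real.sqrt_eq_rpow n]
  congr 1
  rw [Real.sqrt_div' _ (by positivity), Real.sqrt_eq_rpow ((n : ℝ) ^ (1 / 4 : ℝ)),
    ← Real.rpow_mul hn'.le, div_eq_div_iff (by positivity) hn'.ne']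
  have : (n : ℝ) = (n : ℝ) ^ (7 / 8 : ℝ) * (n : ℝ) ^ (1 / 4 * (1 / 2) : ℝ) := by
    rw [← Real.rpow_add hn']; norm_num
  nth_rewrite 2 [this]
  ring

theorem tendsto_rpow_div_self : Tendsto (fun n : ℕ => (n : ℝ) ^ (7 / 8 : ℝ) / n) atTop (𝓝 0) := by
  have h1 : Tendsto (fun n : ℕ => (n : ℝ) ^ (-(1 / 8) : ℝ)) atTop (𝓝 0) :=
    (tendsto_rpow_neg_atTop (by norm_num)).comp tendsto_natCast_atTop_atTop
  refine h1.congr' ?_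
  filter_upwards [eventually_gt_atTop 0] with n hn
  have hn' : (0 : ℝ) < n := by exact_mod_cast hn
  rw [eq_div_iff hn'.ne']
  nth_rewrite 2 [← Real.rpow_one (n : ℝ)]
  rw [← Real.rpow_add hn']
  norm_num

theorem tendsto_log_div_self : Tendsto (fun n : ℕ => Real.log n / n) atTop (𝓝 0) := by
  have := (isLittleO_log_rpow_atTop one_pos).tendsto_div_nhds_zero.comp
    tendsto_natCast_atTop_atTop
  simpa [Function.comp_def] using this

theorem abs_apply_le_l2_opNorm {ι κ : Type*} [Fintype ι] [Fintype κ] [DecidableEq ι]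
    [DecidableEq κ] (M : Matrix ι κ ℝ) (i : ι) (j : κ) : |M i j| ≤ ‖M‖ := by
  refine abs_le_of_sq_le_sq ?_ (norm_nonneg _)
  exact (Finset.single_le_sum (f := fun j => M i j ^ 2) (fun j _ => sq_nonneg _)
    (Finset.mem_univ j)).trans (sum_row_sq_le M i)

theorem l2_opNorm_le_of_abs_le {ι κ : Type*} [Fintype ι] [Fintype κ] [DecidableEq κ]
    {M : Matrix ι κ ℝ} {C : ℝ} (hC : 0 ≤ C) (h : ∀ i j, |M i j| ≤ C) :
    ‖M‖ ≤ √(Fintype.card ι) * √(Fintype.card κ) * C := by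
  refine le_of_sq_le_sq ((l2_opNorm_sq_le_sum_sq M).trans ?_) (by positivity)
  calc _ ≤ ∑ _i : ι, ∑ _j : κ, C ^ 2 := Finset.sum_le_sum fun i _ => Finset.sum_le_sum fun j _ =>
        sq_le_sq.2 ((h i j).trans (le_abs_self C))
    _ = _ := by
      rw [mul_pow, mul_pow, Real.sq_sqrt (by positivity), Real.sq_sqrt (by positivity)]
      simp [mul_assoc]

theorem sqrt_natCast_le (d : ℕ) : √(d : ℝ) ≤ d := by
  rcases Nat.eq_zero_or_pos d with h | h
  · simp [h]
  · exact Real.sqrt_le_self_iff.2 (Or.inr (by exact_mod_cast h))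

variable {d : ℕ} {F : Measure (EuclideanSpace ℝ (Fin d))}

theorem rowMatrix_mul_transpose_add_noise {n : ℕ} (A : Matrix (Fin n) (Fin n) ℝ)
    (x : Fin n → EuclideanSpace ℝ (Fin d)) :
    rowMatrix x * (rowMatrix x)ᵀ + noise A x = A := by
  ext i j
  have : (rowMatrix x * (rowMatrix x)ᵀ) i j = inner ℝ (x i) (x j) := by
    rw [Matrix.mul_apply, PiLp.inner_apply]
    exact Finset.sum_congr rfl fun s _ => by simp [rowMatrix, mul_comm]
  rw [Matrix.add_apply, this]
  simp [noise]

theorem IsInnerProductDistribution.norm_rowMatrix_le (hF : IsInnerProductDistribution F) {n : ℕ}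
    {x : Fin n → EuclideanSpace ℝ (Fin d)} (hx : ∀ i, x i ∈ F.support) : ‖rowMatrix x‖ ≤ √n := by
  refine le_of_sq_le_sq ((l2_opNorm_sq_le_sum_sq _).trans ?_) (Real.sqrt_nonneg _)
  rw [Real.sq_sqrt (by positivity)]
  calc _ ≤ ∑ _i : Fin n, (1 : ℝ) := Finset.sum_le_sum fun i _ => by
        have h1 := hF.norm_le_one (hx i)
        have h2 : ∑ s, rowMatrix x i s ^ 2 = ‖x i‖ ^ 2 := by
          rw [EuclideanSpace.norm_sq_eq]
          simp [rowMatrix]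
        rw [h2]
        exact pow_le_one₀ (norm_nonneg _) h1
    _ = n := by simp

variable {Ω : Type*} [MeasurableSpace Ω] {μ : Measure Ω} [IsProbabilityMeasure μ]
  {A : (n : ℕ) → Ω → Matrix (Fin n) (Fin n) ℝ}
  {X Xhat : (n : ℕ) → Ω → Fin n → EuclideanSpace ℝ (Fin d)}

/-- XᵀEX is only d × d, so its entrywise bounds give order n√log n; passing through ‖X‖‖EX‖ would
lose a factor √n. -/
theorem ae_eventually_norm_noise_mul_le (hF : IsInnerProductDistribution F)
    (hAX : ∀ n, IsRDPG μ F n (A n) (X n)) :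
    ∀ᵐ ω ∂μ, ∀ᶠ n : ℕ in atTop,
      ‖noise (A n ω) (X n ω) * rowMatrix (X n ω)‖ ≤ n * ((6 * d + 1) * √(Real.log n)) ∧
      ‖(rowMatrix (X n ω))ᵀ * noise (A n ω) (X n ω) * rowMatrix (X n ω)‖ ≤
        n * ((6 * d + 1) * √(Real.log n)) := by
  have h1 : ∀ᵐ ω ∂μ, ∀ s t : Fin d, ∀ᶠ n : ℕ in atTop,
      |(fun j => X n ω j s) ⬝ᵥ (noise (A n ω) (X n ω) *ᵥ fun j => X n ω j t)| ≤
        5 * 1 ^ 2 * (n * √(Real.log n)) := by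
    rw [ae_all_iff]; intro s; rw [ae_all_iff]; intro t
    exact ae_eventually_abs_bilinear_le hF hAX (u := fun n x j => x j s) (v := fun n x j => x j t)
      (fun n j => measurable_apply_apply j s) (fun n j => measurable_apply_apply j t) one_pos
      (.of_forall fun n x hx i => hF.abs_apply_le_one (hx i) s)
      (.of_forall fun n x hx i => hF.abs_apply_le_one (hx i) t)
  filter_upwards [h1, ae_eventually_abs_noise_mul_le hF hAX] with ω h1 h2
  have h3 := eventually_all.2 fun s => eventually_all.2 fun t => h1 s t
  filter_upwards [h3, h2] with n h3 h2
  have hs : 0 ≤ √(Real.log n) := Real.sqrt_nonneg _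
  have hd := sqrt_natCast_le d
  constructor
  · refine (l2_opNorm_le_of_abs_le (by positivity) h2).trans ?_
    rw [Fintype.card_fin, Fintype.card_fin]
    calc _ = (√n * √n) * (6 * √d * √(Real.log n)) := by ring
      _ ≤ n * ((6 * d + 1) * √(Real.log n)) := by
        rw [Real.mul_self_sqrt (by positivity)]
        gcongr
        linarith
  · refine (l2_opNorm_le_of_abs_le (C := 5 * 1 ^ 2 * (n * √(Real.log n))) (by positivity)
      fun s t => ?_).trans ?_
    · rw [Matrix.mul_assoc]
      exact h3 s t
    · rw [Fintype.card_fin, Real.mul_self_sqrt (by positivity)]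
      calc _ = n * ((5 * d) * √(Real.log n)) := by ring
        _ ≤ _ := by
          gcongr
          linarith [(Nat.cast_nonneg d : (0 : ℝ) ≤ d)]

/-- Up to an orthogonal transformation, the embedding equals `X + E X Z + R` with `E = A - XXᵀ`,
a small `d × d` matrix `Z` and a negligible remainder `R`. -/
theorem exists_ae_eventually_embedding_expansion (hF : IsInnerProductDistribution F)
    (hΔ : (secondMoment F).rank = d) (hAX : ∀ n, IsRDPG μ F n (A n) (X n))
    (hXhat : ∀ n, d ≤ n → ∀ᵐ ω ∂μ, IsASE (A n ω) (Xhat n ω)) :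
    ∃ K ≥ 0, ∀ᵐ ω ∂μ, ∀ᶠ n : ℕ in atTop, ∃ Q ∈ Matrix.orthogonalGroup (Fin d) ℝ,
      ∃ Z : Matrix (Fin d) (Fin d) ℝ, ‖Z‖ ≤ K / n ∧
        ‖rowMatrix (Xhat n ω) * Qᵀ - rowMatrix (X n ω) -
          noise (A n ω) (X n ω) * rowMatrix (X n ω) * Z‖ ≤ K * rate n := by
  obtain ⟨c, hc, hgram⟩ := exists_ae_eventually_gram_lower_bound hF hΔ hAX
  -- The leading eigenvalues are at least cn/2, so their inverses are at most 2/(cn) ≤ q²/n.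
  set q : ℝ := max 1 √(2 / c) with hq
  have hq1 : 1 ≤ q := le_max_left _ _
  have hqc : 2 / c ≤ q ^ 2 := by
    calc 2 / c = √(2 / c) ^ 2 := (Real.sq_sqrt (by positivity)).symm
      _ ≤ q ^ 2 := by gcongr; exact le_max_right _ _
  set r₀ : ℝ := 6 * d + 1 with hr₀
  have hr₀1 : 1 ≤ r₀ := by rw [hr₀]; linarith [(Nat.cast_nonneg d : (0 : ℝ) ≤ d)]
  refine ⟨7 * q ^ 8 * (2 * r₀ ^ 2), by positivity, ?_⟩
  have h2 : ∀ᵐ ω ∂μ, ∀ n, ∀ i, X n ω i ∈ F.support :=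
    ae_all_iff.2 fun n => (hAX n).ae_mem_support hF
  have h3 : ∀ᵐ ω ∂μ, ∀ n, d ≤ n → IsASE (A n ω) (Xhat n ω) :=
    ae_all_iff.2 fun n => by
      by_cases h : d ≤ n
      · filter_upwards [hXhat n h] with ω hω _ using hω
      · exact .of_forall fun _ h' => absurd h' h
  have hlim1 : ∀ᶠ n : ℕ in atTop, q ^ 2 * (2 * ((n : ℝ) ^ (7 / 8 : ℝ) / n)) < 1 / 2 := by
    have := (tendsto_rpow_div_self.const_mul 2).const_mul (q ^ 2)
    rw [mul_zero, mul_zero] at this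
    exact this.eventually_lt_const (by norm_num)
  have hlim2 : ∀ᶠ n : ℕ in atTop, 7 * q ^ 8 * (r₀ ^ 2 * (Real.log n / n)) < 1 := by
    have := (tendsto_log_div_self.const_mul (r₀ ^ 2)).const_mul (7 * q ^ 8)
    rw [mul_zero, mul_zero] at this
    exact this.eventually_lt_const (by norm_num)
  have hlim3 : ∀ᶠ n : ℕ in atTop, 2 * ((n : ℝ) ^ (7 / 8 : ℝ) / n) < c / 2 := by
    have := tendsto_rpow_div_self.const_mul 2
    rw [mul_zero] at this
    exact this.eventually_lt_const (by positivity)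
  filter_upwards [hgram, h2, h3, ae_eventually_norm_noise_le hF hAX,
    ae_eventually_norm_noise_mul_le hF hAX] with ω hgram h2 h3 h4 h5
  filter_upwards [hgram, h4, h5, hlim1, hlim2, hlim3, eventually_one_le_log, eventually_ge_atTop d,
    eventually_gt_atTop 0] with n hgram h4 h5 hlim1 hlim2 hlim3 hlog hnd hn
  have hn' : (0 : ℝ) < n := by exact_mod_cast hn
  have hL1 : 1 ≤ √(Real.log n) := Real.one_le_sqrt.2 hlog
  have hL2 : √(Real.log n) ^ 2 = Real.log n := Real.sq_sqrt (by linarith)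
  have hgap : 2 * (n : ℝ) ^ (7 / 8 : ℝ) < c * n / 2 := by
    rw [← mul_div_assoc, div_lt_iff₀ hn'] at hlim3
    linarith
  obtain ⟨ev, hev, hg1, hg2⟩ := (h3 n hnd).exists_gram_eq_diagonal h4.1
    (rowMatrix_mul_transpose_add_noise _ (X n ω)) (by positivity) hgram h4.2 hgap
  have hev0 (s) : 0 < ev s := lt_of_lt_of_le (by positivity) (hev s)
  have hDS : diagonal ev * diagonal (fun s => (ev s)⁻¹) = 1 := by
    rw [diagonal_mul_diagonal, ← diagonal_one]
    congr 1
    funext s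
    exact mul_inv_cancel₀ (hev0 s).ne'
  have hS : ‖diagonal fun s => (ev s)⁻¹‖ ≤ q ^ 2 / n := by
    rw [l2_opNorm_diagonal]
    refine (pi_norm_le_iff_of_nonneg (by positivity)).2 fun s => ?_
    rw [Real.norm_eq_abs, abs_of_pos (inv_pos.2 (hev0 s))]
    calc (ev s)⁻¹ ≤ (c * n / 2)⁻¹ := inv_anti₀ (by positivity) (hev s)
      _ = 2 / c / n := by field_simp
      _ ≤ _ := by gcongr
  obtain ⟨Q, hQ, Z, hZ, hR⟩ := exists_orthogonal_embedding_expansion (X := rowMatrix (X n ω))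
    (Y := rowMatrix (Xhat n ω)) (E := noise (A n ω) (X n ω)) (N := n) (q := q)
    (ε := 2 * (n : ℝ) ^ (7 / 8 : ℝ)) (r := r₀ * √(Real.log n)) h4.1 (diagonal_transpose _) hDS hg1
    (by rw [rowMatrix_mul_transpose_add_noise]; exact hg2) hn' hq1
    (one_le_mul_of_one_le_of_one_le hr₀1 hL1) (hF.norm_rowMatrix_le (h2 n)) hS h4.2 h5.1 h5.2
    (by
      refine le_trans (le_of_eq ?_) hlim1.le
      ring)
    (by
      refine lt_of_le_of_lt (le_of_eq ?_) hlim2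
      rw [mul_pow, hL2]
      ring)
  have hr₀2 : r₀ ≤ r₀ ^ 2 := by nlinarith
  refine ⟨Q, hQ, Z, hZ.trans ?_, hR.trans ?_⟩
  · refine div_le_div_of_nonneg_right ?_ hn'.le
    exact le_mul_of_one_le_right (by positivity) (by nlinarith)
  · rw [mul_assoc (7 * q ^ 8)]
    gcongr
    rw [mul_pow, hL2, rate, mul_add]
    refine add_le_add ?_ ?_
    · calc _ = 2 * r₀ * ((n : ℝ) ^ (7 / 8 : ℝ) * √(Real.log n) / n) := by ring
        _ ≤ _ := by gcongr
    · calc _ = r₀ ^ 2 * (Real.log n / √n) := by ring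
        _ ≤ _ := by
          gcongr
          linarith [sq_nonneg r₀]

end EmbeddingError

/-! ### Three bounds on the aligned error. -/

section AlignedError

open Matrix
open scoped Matrix.Norms.L2Operator

variable {d : ℕ} {F : Measure (EuclideanSpace ℝ (Fin d))}

theorem norm_le_sum_abs (x : EuclideanSpace ℝ (Fin d)) : ‖x‖ ≤ ∑ s, |x s| := by
  refine le_of_sq_le_sq ?_ (by positivity)
  rw [EuclideanSpace.norm_sq_eq]
  exact Finset.sum_sq_le_sq_sum_of_nonneg fun s _ => abs_nonneg (x s)

theorem rate_nonneg (n : ℕ) : 0 ≤ rate n := by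
  have := Real.log_natCast_nonneg n
  unfold rate
  positivity

theorem log_le_sqrt_mul_rate {n : ℕ} (hn : 0 < n) : Real.log n ≤ √n * rate n := by
  have hn' : (0 : ℝ) < √n := Real.sqrt_pos.2 (by exact_mod_cast hn)
  rw [rate, mul_add, mul_div_cancel₀ _ hn'.ne']
  have : 0 ≤ √n * ((n : ℝ) ^ (7 / 8 : ℝ) * √(Real.log n) / n) := by positivity
  linarith

/-- The difference of the aligned embedding and the latent position of the vertex `i`. -/
def alignedError {n : ℕ} (Q : Matrix (Fin d) (Fin d) ℝ) (xhat x : Fin n → EuclideanSpace ℝ (Fin d))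
    (i : Fin n) : EuclideanSpace ℝ (Fin d) :=
  Matrix.toEuclideanLin Q (xhat i) - x i

theorem alignedError_apply {n : ℕ} (Q : Matrix (Fin d) (Fin d) ℝ)
    (xhat x : Fin n → EuclideanSpace ℝ (Fin d)) (i : Fin n) (s : Fin d) :
    alignedError Q xhat x i s = (rowMatrix xhat * Qᵀ - rowMatrix x) i s := by
  have : (rowMatrix xhat * Qᵀ) i s = (Matrix.toEuclideanLin Q (xhat i)) s := by
    rw [Matrix.mul_apply]
    simp [rowMatrix, Matrix.toLpLin_apply, mulVec, dotProduct, mul_comm]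
  rw [Matrix.sub_apply, this]
  rfl

theorem abs_mul_apply_le {ι κ : Type*} [Fintype ι] [Fintype κ] [DecidableEq ι] [DecidableEq κ]
    (M : Matrix ι κ ℝ) (Z : Matrix κ κ ℝ) {C : ℝ} (h : ∀ i j, |M i j| ≤ C) (i : ι) (j : κ) :
    |(M * Z) i j| ≤ Fintype.card κ * (C * ‖Z‖) := by
  rw [Matrix.mul_apply]
  calc _ ≤ ∑ k, |M i k * Z k j| := Finset.abs_sum_le_sum_abs _ _
    _ ≤ ∑ _k : κ, C * ‖Z‖ := Finset.sum_le_sum fun k _ => by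
        rw [abs_mul]
        have hC : 0 ≤ C := (abs_nonneg _).trans (h i k)
        have := h i k
        have := abs_apply_le_l2_opNorm Z k j
        gcongr
    _ = _ := by simp

variable {Ω : Type*} [MeasurableSpace Ω] {μ : Measure Ω} [IsProbabilityMeasure μ]
  {A : (n : ℕ) → Ω → Matrix (Fin n) (Fin n) ℝ}
  {X Xhat : (n : ℕ) → Ω → Fin n → EuclideanSpace ℝ (Fin d)}

/-- One Q serves all three bounds: the uniform one keeps the points where the Taylor bound is valid,
the second controls the quadratic term, the third the linear term. The weights G depend on X alone,
which is what makes the third better than Cauchy–Schwarz. -/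
theorem exists_ae_eventually_alignedError_le (hF : IsInnerProductDistribution F)
    (hΔ : (secondMoment F).rank = d) (hAX : ∀ n, IsRDPG μ F n (A n) (X n))
    (hXhat : ∀ n, d ≤ n → ∀ᵐ ω ∂μ, IsASE (A n ω) (Xhat n ω))
    {G : (n : ℕ) → (Fin n → EuclideanSpace ℝ (Fin d)) → Fin n → Fin d → ℝ}
    (hG : ∀ n i s, Measurable fun x => G n x i s) {B : ℝ}
    (hGB : ∀ᶠ n in atTop, ∀ x : Fin n → EuclideanSpace ℝ (Fin d), (∀ i, x i ∈ F.support) →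
      ∀ i s, |G n x i s| ≤ B) :
    ∃ K ≥ 0, ∀ᵐ ω ∂μ, ∀ᶠ n : ℕ in atTop, ∃ Q ∈ Matrix.orthogonalGroup (Fin d) ℝ,
      (∀ i, ‖alignedError Q (Xhat n ω) (X n ω) i‖ ≤ K * rate n) ∧
      ∑ i, ‖alignedError Q (Xhat n ω) (X n ω) i‖ ^ 2 ≤ K * (√n * rate n) ∧
      |∑ i, ∑ s, G n (X n ω) i s * alignedError Q (Xhat n ω) (X n ω) i s| ≤
        K * (√n * rate n) := by
  obtain ⟨K, hK, hexp⟩ := exists_ae_eventually_embedding_expansion hF hΔ hAX hXhat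
  set B' : ℝ := max B 1 with hB'
  have hB'1 : 1 ≤ B' := le_max_right _ _
  have hGB' : ∀ᶠ n in atTop, ∀ x : Fin n → EuclideanSpace ℝ (Fin d), (∀ i, x i ∈ F.support) →
      ∀ i s, |G n x i s| ≤ B' := by
    filter_upwards [hGB] with n hn x hx i s using (hn x hx i s).trans (le_max_left _ _)
  have hbil : ∀ᵐ ω ∂μ, ∀ s t : Fin d, ∀ᶠ n : ℕ in atTop,
      |(fun i => G n (X n ω) i s) ⬝ᵥ (noise (A n ω) (X n ω) *ᵥ fun j => X n ω j t)| ≤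
        5 * B' ^ 2 * (n * √(Real.log n)) := by
    rw [ae_all_iff]; intro s; rw [ae_all_iff]; intro t
    exact ae_eventually_abs_bilinear_le hF hAX (u := fun n x i => G n x i s)
      (v := fun n x j => x j t) (fun n i => hG n i s) (fun n j => measurable_apply_apply j t)
      (by positivity) (by filter_upwards [hGB'] with n hn x hx i using hn x hx i s)
      (.of_forall fun n x hx i => (hF.abs_apply_le_one (hx i) t).trans hB'1)
  have hsupp : ∀ᵐ ω ∂μ, ∀ n, ∀ i, X n ω i ∈ F.support :=
    ae_all_iff.2 fun n => (hAX n).ae_mem_support hF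
  have hrate1 : ∀ᶠ n in atTop, rate n ≤ 1 := tendsto_rate.eventually_le_const one_pos
  set r₀ : ℝ := 6 * d + 1 with hr₀
  have hr₀1 : 1 ≤ r₀ := by rw [hr₀]; linarith [(Nat.cast_nonneg d : (0 : ℝ) ≤ d)]
  set K₁ : ℝ := d * (d * (6 * K) + K)
  set K₂ : ℝ := d * (2 * r₀ * K) ^ 2
  set K₃ : ℝ := d * d * (5 * B' ^ 2 * K) + d * B' * K
  have hK₁ : 0 ≤ K₁ := by positivity
  have hK₂ : 0 ≤ K₂ := by positivity
  have hK₃ : 0 ≤ K₃ := by positivity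
  refine ⟨K₁ + K₂ + K₃, by positivity, ?_⟩
  filter_upwards [hexp, hbil, hsupp, ae_eventually_abs_noise_mul_le hF hAX,
    ae_eventually_norm_noise_mul_le hF hAX] with ω hexp hbil hsupp hrow hnorm
  have hbil := eventually_all.2 fun s => eventually_all.2 fun t => hbil s t
  filter_upwards [hexp, hbil, hrow, hnorm, hGB', hrate1, eventually_one_le_log,
    eventually_gt_atTop 0] with n hexp hbil hrow hnorm hGB' hrate1 hlog hn
  obtain ⟨Q, hQ, Z, hZ, hR⟩ := hexp
  have hn' : (0 : ℝ) < n := by exact_mod_cast hn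
  have hsn : 0 < √(n : ℝ) := Real.sqrt_pos.2 hn'
  have hsn2 : √(n : ℝ) * √n = n := Real.mul_self_sqrt hn'.le
  have hρ : 0 ≤ rate n := rate_nonneg n
  have hlogρ := log_le_sqrt_mul_rate hn
  have hL1 : 1 ≤ √(Real.log n) := Real.one_le_sqrt.2 hlog
  have hL2 : √(Real.log n) ^ 2 = Real.log n := Real.sq_sqrt (by linarith)
  have hLρ : √(Real.log n) ≤ √n * rate n := by nlinarith
  set D := rowMatrix (Xhat n ω) * Qᵀ - rowMatrix (X n ω) with hD
  set M := noise (A n ω) (X n ω) * rowMatrix (X n ω) with hM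
  set R := D - M * Z with hRdef
  have hDMR : D = M * Z + R := by rw [hRdef]; abel
  have hDn : ‖D‖ ≤ 2 * r₀ * K * √(Real.log n) := by
    calc ‖D‖ ≤ ‖M‖ * ‖Z‖ + ‖R‖ := by
          rw [hDMR]
          exact (norm_add_le _ _).trans (add_le_add (l2_opNorm_mul _ _) le_rfl)
      _ ≤ (n * (r₀ * √(Real.log n))) * (K / n) + K * 1 := by
          gcongr
          · exact hnorm.1
          · exact hR.trans (by gcongr)
      _ = K * (r₀ * √(Real.log n)) + K * 1 := by field_simp
      _ ≤ K * (r₀ * √(Real.log n)) + K * (r₀ * √(Real.log n)) := by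
          gcongr
          exact one_le_mul_of_one_le_of_one_le hr₀1 hL1
      _ = _ := by ring
  have hle {a : ℝ} (ha : 0 ≤ a) {k : ℝ} (hk : k ≤ K₁ + K₂ + K₃) {y : ℝ} (hy : y ≤ k * a) :
      y ≤ (K₁ + K₂ + K₃) * a := hy.trans (by gcongr)
  refine ⟨Q, hQ, fun i => hle hρ (k := K₁) (by linarith) ?_,
    hle (by positivity) (k := K₂) (by linarith) ?_, hle (by positivity) (k := K₃) (by linarith) ?_⟩
  · have h1 (s : Fin d) : |D i s| ≤ (d * (6 * K) + K) * rate n := by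
      calc |D i s| ≤ |(M * Z) i s| + |R i s| := by
            rw [hDMR]
            exact abs_add_le _ _
        _ ≤ d * (6 * (√n * √(Real.log n)) * (K / n)) + K * rate n := by
            have h2 := abs_mul_apply_le M Z hrow i s
            rw [Fintype.card_fin] at h2
            refine add_le_add (h2.trans ?_) ((abs_apply_le_l2_opNorm R i s).trans hR)
            gcongr
        _ = d * (6 * K) * (√(Real.log n) / √n) + K * rate n := by
            have h2 : K / n = K / √n / √n := by rw [div_div, hsn2]
            rw [h2]
            field_simp
        _ ≤ d * (6 * K) * rate n + K * rate n := by
            gcongr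
            rw [div_le_iff₀ hsn]
            linarith
        _ = _ := by ring
    refine (norm_le_sum_abs _).trans ?_
    simp_rw [alignedError_apply]
    calc _ ≤ ∑ _s : Fin d, (d * (6 * K) + K) * rate n := Finset.sum_le_sum fun s _ => h1 s
      _ = _ := by simp [K₁, mul_assoc]
  · have h1 : ∑ i, ‖alignedError Q (Xhat n ω) (X n ω) i‖ ^ 2 = ∑ i, ∑ s, D i s ^ 2 := by
      refine Finset.sum_congr rfl fun i _ => ?_
      rw [EuclideanSpace.norm_sq_eq]
      simp_rw [Real.norm_eq_abs, sq_abs, alignedError_apply]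
      rfl
    rw [h1]
    calc _ ≤ d * ‖D‖ ^ 2 := by simpa using sum_sq_le_card_mul D
      _ ≤ d * (2 * r₀ * K * √(Real.log n)) ^ 2 := by gcongr
      _ = K₂ * Real.log n := by rw [mul_pow _ √(Real.log n), hL2, ← mul_assoc]
      _ ≤ _ := by gcongr
  · simp_rw [alignedError_apply]
    change |∑ i, ∑ s, G n (X n ω) i s * D i s| ≤ _
    -- Z depends on the edges, so concentration does not apply to GᵀEXZ directly. Pulling Z out
    -- leaves d² bilinear forms of E in functions of X, and Z enters only through its norm.
    have h1 : ∑ i, ∑ s, G n (X n ω) i s * D i s =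
        ∑ s, ∑ t, Z t s * ((fun i => G n (X n ω) i s) ⬝ᵥ
          (noise (A n ω) (X n ω) *ᵥ fun j => X n ω j t)) +
        ∑ i, ∑ s, G n (X n ω) i s * R i s := by
      have h2 : ∑ s, ∑ t, Z t s * ((fun i => G n (X n ω) i s) ⬝ᵥ
          (noise (A n ω) (X n ω) *ᵥ fun j => X n ω j t)) =
          ∑ i, ∑ s, G n (X n ω) i s * (M * Z) i s := by
        rw [Finset.sum_comm (f := fun i s => G n (X n ω) i s * (M * Z) i s)]
        refine Finset.sum_congr rfl fun s _ => ?_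
        simp only [dotProduct, Finset.mul_sum, Matrix.mul_apply (M := M)]
        rw [Finset.sum_comm]
        refine Finset.sum_congr rfl fun i _ => Finset.sum_congr rfl fun t _ => ?_
        change Z t s * (_ * M i t) = _
        ring
      rw [h2, ← Finset.sum_add_distrib]
      refine Finset.sum_congr rfl fun i _ => ?_
      rw [← Finset.sum_add_distrib]
      refine Finset.sum_congr rfl fun s _ => ?_
      rw [hDMR, Matrix.add_apply, mul_add]
    rw [h1]
    have h3 : |∑ s, ∑ t, Z t s * ((fun i => G n (X n ω) i s) ⬝ᵥ
          (noise (A n ω) (X n ω) *ᵥ fun j => X n ω j t))| ≤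
        d * d * (5 * B' ^ 2 * K) * (√n * rate n) := by
      calc _ ≤ ∑ _s : Fin d, ∑ _t : Fin d, (K / n) * (5 * B' ^ 2 * (n * √(Real.log n))) := by
            refine (Finset.abs_sum_le_sum_abs _ _).trans (Finset.sum_le_sum fun s _ => ?_)
            refine (Finset.abs_sum_le_sum_abs _ _).trans (Finset.sum_le_sum fun t _ => ?_)
            rw [abs_mul]
            exact mul_le_mul ((abs_apply_le_l2_opNorm Z t s).trans hZ) (hbil s t) (abs_nonneg _)
              (by positivity)
        _ = d * d * (5 * B' ^ 2 * K) * √(Real.log n) := by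
            simp
            field_simp
        _ ≤ _ := by gcongr
    have h4 : |∑ i, ∑ s, G n (X n ω) i s * R i s| ≤ d * B' * K * (√n * rate n) := by
      refine abs_le_of_sq_le_sq ?_ (by positivity)
      rw [← Fintype.sum_prod_type']
      refine (Finset.sum_mul_sq_le_sq_mul_sq _ _ _).trans ?_
      rw [Fintype.sum_prod_type' (f := fun i s => G n (X n ω) i s ^ 2),
        Fintype.sum_prod_type' (f := fun i s => R i s ^ 2)]
      calc _ ≤ (∑ _i : Fin n, ∑ _s : Fin d, B' ^ 2) * (d * (K * rate n) ^ 2) := by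
            refine mul_le_mul (Finset.sum_le_sum fun i _ => Finset.sum_le_sum fun s _ =>
              sq_le_sq.2 ((hGB' _ (hsupp n) i s).trans (le_abs_self _))) ?_
              (Finset.sum_nonneg fun i _ => Finset.sum_nonneg fun s _ => sq_nonneg (R i s))
              (Finset.sum_nonneg fun i _ => Finset.sum_nonneg fun s _ => sq_nonneg B')
            refine (sum_sq_le_card_mul R).trans ?_
            rw [Fintype.card_fin]
            exact mul_le_mul_of_nonneg_left (pow_le_pow_left₀ (norm_nonneg _) hR 2)
              (Nat.cast_nonneg d)
        _ = _ := by
            simp only [Finset.sum_const, Finset.card_univ, Fintype.card_fin, nsmul_eq_mul]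
            linear_combination (-(d ^ 2 * B' ^ 2 * K ^ 2 * rate n ^ 2)) * hsn2
    refine (abs_add_le _ _).trans ?_
    calc _ ≤ _ := add_le_add h3 h4
      _ = _ := by simp only [K₃]; ring

end AlignedError

/-! ### Taylor expansion of the U-statistic. -/

section UStatistic

open Matrix

variable {d m n : ℕ} {F : Measure (EuclideanSpace ℝ (Fin d))}
  {h : (Fin m → EuclideanSpace ℝ (Fin d)) → ℝ}

theorem IsInnerProductDistribution.isCompact_supportPow (hF : IsInnerProductDistribution F) :
    IsCompact (supportPow F m) := by
  have h1 : IsCompact F.support := by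
    refine Metric.isCompact_of_isClosed_isBounded Measure.isClosed_support ?_
    exact (Metric.isBounded_closedBall (x := (0 : EuclideanSpace ℝ (Fin d))) (r := 1)).subset
      fun x hx => by simpa using hF.norm_le_one hx
  have h2 : supportPow F m = Set.univ.pi fun _ => F.support := by
    ext z
    simp [supportPow]
  rw [h2]
  exact isCompact_univ_pi fun _ => h1

/-- Compactness of the support gives one radius ε whose balls all lie in S. Balls are convex, so the
mean value inequality applies to the derivative and then to h, although S itself need not be convex.
-/
theorem HasBoundedHessianNearSupport.exists_taylor_bound (hF : IsInnerProductDistribution F)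
    (hh : HasBoundedHessianNearSupport F h) :
    ∃ ε > 0, ∃ C₁ ≥ 0, ∃ C₂ ≥ 0, ∀ z ∈ supportPow F m, ‖fderiv ℝ h z‖ ≤ C₁ ∧
      ∀ w, ‖w - z‖ < ε → |h w - h z - fderiv ℝ h z (w - z)| ≤ C₂ * ‖w - z‖ ^ 2 := by
  obtain ⟨-, S, hSo, hS, hdiff, C, hC⟩ := hh
  have hK := hF.isCompact_supportPow (m := m)
  obtain ⟨ε, hε, hthick⟩ := hK.exists_thickening_subset_open hSo hS
  obtain ⟨C₁, hC₁⟩ := hK.exists_bound_of_continuousOn (f := fderiv ℝ h)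
    fun z hz => (hdiff z (hS hz)).2.continuousAt.continuousWithinAt
  refine ⟨ε, hε, max C₁ 0, le_max_right _ _, max C 0, le_max_right _ _, fun z hz =>
    ⟨(hC₁ z hz).trans (le_max_left _ _), fun w hw => ?_⟩⟩
  have hball : ∀ y ∈ Metric.ball z ε, y ∈ S := fun y hy =>
    hthick (Metric.mem_thickening_iff.2 ⟨z, hz, hy⟩)
  have hgrad (y) (hy : y ∈ Metric.ball z ε) :
      ‖fderiv ℝ h y - fderiv ℝ h z‖ ≤ max C 0 * ‖y - z‖ :=
    (convex_ball z ε).norm_image_sub_le_of_norm_fderiv_le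
      (fun y hy => (hdiff y (hball y hy)).2)
      (fun y hy => (hC y (hball y hy)).trans (le_max_left _ _)) (Metric.mem_ball_self hε) hy
  have hsub : ∀ y ∈ Metric.closedBall z ‖w - z‖, y ∈ Metric.ball z ε := fun y hy =>
    Metric.closedBall_subset_ball hw hy
  have h1 := (convex_closedBall z ‖w - z‖).norm_image_sub_le_of_norm_fderiv_le'
    (f := h) (φ := fderiv ℝ h z) (C := max C 0 * ‖w - z‖)
    (fun y hy => (hdiff y (hball y (hsub y hy))).1) (fun y hy => by
      refine (hgrad y (hsub y hy)).trans ?_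
      have : ‖y - z‖ ≤ ‖w - z‖ := by simpa [dist_eq_norm] using hy
      gcongr)
    (Metric.mem_closedBall_self (norm_nonneg _)) (y := w) (by simp [dist_eq_norm])
  rw [Real.norm_eq_abs] at h1
  rw [sq, ← mul_assoc]
  exact h1

-- A vertex lies in at most (n-1 choose m-1) of the m-subsets: removing it from the image of c is
-- injective. It occurs at most once in each strictly increasing c.
open Classical in
theorem mul_card_strictMono_le (i : Fin n) :
    n * ∑ c : Fin m → Fin n with StrictMono c, (∑ k, if c k = i then 1 else 0) ≤
      m * n.choose m := by
  obtain _ | m := m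
  · simp
  obtain _ | n := n
  · exact i.elim0
  have h1 : ∑ c : Fin (m + 1) → Fin (n + 1) with StrictMono c, (∑ k, if c k = i then 1 else 0) ≤
      n.choose m := by
    calc _ ≤ ∑ c : Fin (m + 1) → Fin (n + 1) with StrictMono c,
          if i ∈ Finset.univ.image c then 1 else 0 := by
          refine Finset.sum_le_sum fun c hc => ?_
          have hinj := (Finset.mem_filter.1 hc).2.injective
          rw [Finset.sum_boole, Nat.cast_id]
          split_ifs with hi
          · refine Finset.card_le_one.2 fun a ha b hb => hinj ?_
            rw [(Finset.mem_filter.1 ha).2, (Finset.mem_filter.1 hb).2]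
          · refine (Finset.card_eq_zero.2 (Finset.filter_eq_empty_iff.2 fun k _ hk => hi ?_)).le
            exact Finset.mem_image.2 ⟨k, Finset.mem_univ k, hk⟩
      _ = ((Finset.univ.filter fun c : Fin (m + 1) → Fin (n + 1) => StrictMono c).filter
            fun c => i ∈ Finset.univ.image c).card := by
          rw [Finset.sum_boole, Nat.cast_id]
      _ ≤ ((Finset.univ.erase i).powersetCard m).card := by
          refine Finset.card_le_card_of_injOn (fun c => (Finset.univ.image c).erase i) ?_ ?_
          · intro c hc
            rw [Finset.mem_coe, Finset.mem_filter, Finset.mem_filter] at hc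
            rw [Finset.mem_coe, Finset.mem_powersetCard]
            refine ⟨Finset.erase_subset_erase _ (Finset.subset_univ _), ?_⟩
            rw [Finset.card_erase_of_mem hc.2, Finset.card_image_of_injective _ hc.1.2.injective]
            simp
          · intro c hc c' hc' hcc
            rw [Finset.mem_coe, Finset.mem_filter, Finset.mem_filter] at hc hc'
            have h2 : Finset.univ.image c = Finset.univ.image c' := by
              rw [← Finset.insert_erase hc.2, ← Finset.insert_erase hc'.2]
              exact congrArg (insert i) hcc
            refine (StrictMono.range_inj hc.1.2 hc'.1.2).1 ?_
            simpa using congrArg (fun s : Finset (Fin (n + 1)) => (s : Set (Fin (n + 1)))) h2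
      _ = n.choose m := by simp
  calc _ ≤ (n + 1) * n.choose m := Nat.mul_le_mul_left _ h1
    _ = _ := by rw [Nat.add_one_mul_choose_eq, mul_comm]

open Classical in
theorem choose_inv_mul_card_strictMono_le (i : Fin n) :
    ((n.choose m : ℕ) : ℝ)⁻¹ *
      ∑ c : Fin m → Fin n with StrictMono c, (∑ k, if c k = i then (1 : ℝ) else 0) ≤ m / n := by
  have hn : (0 : ℝ) < n := by exact_mod_cast i.pos
  have h1 : (n : ℝ) * ∑ c : Fin m → Fin n with StrictMono c, (∑ k, if c k = i then (1 : ℝ) else 0) ≤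
      m * (n.choose m : ℕ) := by exact_mod_cast mul_card_strictMono_le (m := m) i
  -- For m > n the binomial coefficient is 0, and so is its inverse by convention.
  rcases Nat.eq_zero_or_pos (n.choose m) with h0 | h0
  · rw [h0]
    simp only [Nat.cast_zero, _root_.inv_zero, zero_mul]
    exact div_nonneg (Nat.cast_nonneg m) hn.le
  · have h0' : (0 : ℝ) < (n.choose m : ℕ) := by exact_mod_cast h0
    rw [inv_mul_le_iff₀ h0', ← mul_div_assoc, le_div_iff₀ hn]
    linarith

open Classical in
/-- `n` times the gradient of the U-statistic in the position of the vertex `i`, in coordinates. -/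
def uStatGradient (h : (Fin m → EuclideanSpace ℝ (Fin d)) → ℝ)
    (x : Fin n → EuclideanSpace ℝ (Fin d)) (i : Fin n) (s : Fin d) : ℝ :=
  n * (((n.choose m : ℕ) : ℝ)⁻¹ * ∑ c : Fin m → Fin n with StrictMono c, ∑ k,
    if c k = i then fderiv ℝ h (fun k => x (c k)) (Pi.single k (EuclideanSpace.single s 1)) else 0)

/-- No regularity of h is needed: `fderiv` applied to a fixed vector is measurable for every
function. -/
theorem measurable_uStatGradient (h : (Fin m → EuclideanSpace ℝ (Fin d)) → ℝ) (i : Fin n)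
    (s : Fin d) : Measurable fun x : Fin n → EuclideanSpace ℝ (Fin d) => uStatGradient h x i s := by
  classical
  refine measurable_const.mul (measurable_const.mul (Finset.measurable_sum _ fun c _ =>
    Finset.measurable_sum _ fun k _ => ?_))
  split_ifs
  · exact (measurable_fderiv_apply_const ℝ h _).comp
      (measurable_pi_lambda _ fun k => measurable_pi_apply (c k))
  · exact measurable_const

/-- Vertex i takes part in a fraction of at most m/n of the tuples, which cancels the factor n. -/
theorem abs_uStatGradient_le {C₁ : ℝ} (hC₁ : 0 ≤ C₁)
    (hh : ∀ z ∈ supportPow F m, ‖fderiv ℝ h z‖ ≤ C₁) {x : Fin n → EuclideanSpace ℝ (Fin d)}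
    (hx : ∀ i, x i ∈ F.support) (i : Fin n) (s : Fin d) : |uStatGradient h x i s| ≤ m * C₁ := by
  classical
  have hn : (0 : ℝ) < n := by exact_mod_cast i.pos
  rw [uStatGradient, abs_mul, abs_mul, abs_of_pos hn, abs_of_nonneg (by positivity)]
  calc _ ≤ n * (((n.choose m : ℕ) : ℝ)⁻¹ * ∑ c : Fin m → Fin n with StrictMono c, ∑ k,
        C₁ * if c k = i then (1 : ℝ) else 0) := by
        gcongr
        refine (Finset.abs_sum_le_sum_abs _ _).trans (Finset.sum_le_sum fun c _ => ?_)
        refine (Finset.abs_sum_le_sum_abs _ _).trans (Finset.sum_le_sum fun k _ => ?_)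
        split_ifs
        · rw [← Real.norm_eq_abs, mul_one]
          refine ((fderiv ℝ h fun k => x (c k)).le_opNorm _).trans ?_
          rw [← mul_one C₁]
          have h1 : ‖(Pi.single k (EuclideanSpace.single s (1 : ℝ)) :
              Fin m → EuclideanSpace ℝ (Fin d))‖ ≤ 1 := by
            rw [Pi.norm_single]
            simp
          exact mul_le_mul (hh _ fun k => hx (c k)) h1 (norm_nonneg _) hC₁
        · simp
    _ = n * (C₁ * (((n.choose m : ℕ) : ℝ)⁻¹ * ∑ c : Fin m → Fin n with StrictMono c, ∑ k,
        if c k = i then (1 : ℝ) else 0)) := by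
        simp only [← Finset.mul_sum]
        ring
    _ ≤ n * (C₁ * (m / n)) := by
        gcongr
        exact choose_inv_mul_card_strictMono_le i
    _ = _ := by field_simp

-- Regroups the first-order Taylor terms by vertex instead of by tuple.
open Classical in
theorem sum_uStatGradient_mul (x D : Fin n → EuclideanSpace ℝ (Fin d)) (hn : 0 < n) :
    (n : ℝ)⁻¹ * ∑ i, ∑ s, uStatGradient h x i s * D i s =
      ((n.choose m : ℕ) : ℝ)⁻¹ * ∑ c : Fin m → Fin n with StrictMono c,
        fderiv ℝ h (fun k => x (c k)) (fun k => D (c k)) := by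
  have hn' : (n : ℝ) ≠ 0 := by exact_mod_cast hn.ne'
  obtain ⟨a, ha⟩ : ∃ a : (Fin m → Fin n) → Fin n → Fin d → ℝ, ∀ c i s, a c i s =
      ∑ k, if c k = i then fderiv ℝ h (fun k => x (c k))
        (Pi.single k (EuclideanSpace.single s 1)) else 0 := ⟨_, fun _ _ _ => rfl⟩
  have h1 (c : Fin m → Fin n) : fderiv ℝ h (fun k => x (c k)) (fun k => D (c k)) =
      ∑ i, ∑ s, a c i s * D i s := by
    have h2 : (fun k => D (c k)) = ∑ k, ∑ s, D (c k) s •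
        (Pi.single k (EuclideanSpace.single s (1 : ℝ)) : Fin m → EuclideanSpace ℝ (Fin d)) := by
      funext k
      simp only [Finset.sum_apply, Pi.smul_apply]
      rw [Finset.sum_eq_single k]
      · ext t
        simp [Pi.single_apply]
      · intro b _ hb
        simp [Pi.single_eq_of_ne' hb]
      · simp
    conv_lhs => rw [h2]
    simp only [map_sum, map_smul, smul_eq_mul, ha, Finset.sum_mul, ite_mul, zero_mul]
    refine Eq.trans ?_ (Finset.sum_congr rfl fun i _ => Finset.sum_comm)
    refine Eq.trans ?_ Finset.sum_comm
    refine Finset.sum_congr rfl fun k _ => ?_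
    rw [Finset.sum_comm]
    refine Finset.sum_congr rfl fun s _ => ?_
    rw [Finset.sum_ite_eq]
    simp [mul_comm]
  simp only [h1, uStatGradient, ← ha]
  simp only [Finset.mul_sum, Finset.sum_mul]
  rw [Finset.sum_congr rfl fun i _ => Finset.sum_comm, Finset.sum_comm]
  refine Finset.sum_congr rfl fun c _ => Finset.sum_congr rfl fun i _ =>
    Finset.sum_congr rfl fun s _ => ?_
  field_simp

/-- First-order expansion of a U-statistic with a quadratic error bound. -/
theorem abs_uStat_sub_le {ε C₂ : ℝ} (hε : 0 < ε) (hC₂ : 0 ≤ C₂)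
    (hh : ∀ z ∈ supportPow F m, ∀ w, ‖w - z‖ < ε →
      |h w - h z - fderiv ℝ h z (w - z)| ≤ C₂ * ‖w - z‖ ^ 2)
    {x y : Fin n → EuclideanSpace ℝ (Fin d)} (hn : 0 < n) (hx : ∀ i, x i ∈ F.support)
    (hxy : ∀ i, ‖y i - x i‖ < ε) :
    |uStat h y - uStat h x| ≤
      (n : ℝ)⁻¹ * |∑ i, ∑ s, uStatGradient h x i s * (y i - x i) s| +
        C₂ * (m / n * ∑ i, ‖y i - x i‖ ^ 2) := by
  classical
  have hn' : (0 : ℝ) < n := by exact_mod_cast hn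
  have h1 := sum_uStatGradient_mul (h := h) x (fun i => y i - x i) hn
  have h2 : uStat h y - uStat h x =
      (n : ℝ)⁻¹ * ∑ i, ∑ s, uStatGradient h x i s * (y i - x i) s +
      ((n.choose m : ℕ) : ℝ)⁻¹ * ∑ c : Fin m → Fin n with StrictMono c,
        (h (fun k => y (c k)) - h (fun k => x (c k)) -
          fderiv ℝ h (fun k => x (c k)) (fun k => y (c k) - x (c k))) := by
    rw [h1, uStat, uStat, Finset.sum_sub_distrib, Finset.sum_sub_distrib]
    ring
  rw [h2]
  refine (abs_add_le _ _).trans (add_le_add (le_of_eq ?_) ?_)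
  · rw [abs_mul, abs_of_pos (inv_pos.2 hn')]
  rw [abs_mul, abs_of_nonneg (by positivity)]
  have h3 (c : Fin m → Fin n) : |h (fun k => y (c k)) - h (fun k => x (c k)) -
      fderiv ℝ h (fun k => x (c k)) (fun k => y (c k) - x (c k))| ≤
      C₂ * ∑ i, ‖y i - x i‖ ^ 2 * ∑ k, if c k = i then (1 : ℝ) else 0 := by
    refine (hh (fun k => x (c k)) (fun k => hx (c k)) (fun k => y (c k))
      ((pi_norm_lt_iff hε).2 fun k => hxy (c k))).trans ?_
    gcongr
    have h4 : ‖(fun k => y (c k)) - fun k => x (c k)‖ ^ 2 ≤ ∑ k, ‖y (c k) - x (c k)‖ ^ 2 := by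
      have h0 : 0 ≤ ∑ k, ‖y (c k) - x (c k)‖ ^ 2 := by positivity
      rw [← Real.le_sqrt (norm_nonneg _) h0]
      refine (pi_norm_le_iff_of_nonneg (Real.sqrt_nonneg _)).2 fun k => ?_
      exact Real.le_sqrt_of_sq_le (Finset.single_le_sum
        (f := fun k => ‖y (c k) - x (c k)‖ ^ 2) (fun k _ => sq_nonneg _) (Finset.mem_univ k))
    refine h4.trans (le_of_eq ?_)
    simp only [Finset.mul_sum, mul_ite, mul_one, mul_zero]
    rw [Finset.sum_comm]
    simp
  calc _ ≤ ((n.choose m : ℕ) : ℝ)⁻¹ * ∑ c : Fin m → Fin n with StrictMono c,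
        C₂ * ∑ i, ‖y i - x i‖ ^ 2 * ∑ k, if c k = i then (1 : ℝ) else 0 := by
        gcongr
        exact (Finset.abs_sum_le_sum_abs _ _).trans (Finset.sum_le_sum fun c _ => h3 c)
    _ = C₂ * ∑ i, ‖y i - x i‖ ^ 2 * (((n.choose m : ℕ) : ℝ)⁻¹ *
        ∑ c : Fin m → Fin n with StrictMono c, ∑ k, if c k = i then (1 : ℝ) else 0) := by
        rw [← Finset.mul_sum, Finset.sum_comm, mul_left_comm, Finset.mul_sum (a := (_ : ℝ)⁻¹)]
        congr 1
        refine Finset.sum_congr rfl fun i _ => ?_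
        rw [← Finset.mul_sum]
        ring
    _ ≤ C₂ * ∑ i, ‖y i - x i‖ ^ 2 * (m / n) := by
        gcongr with i
        exact choose_inv_mul_card_strictMono_le i
    _ = _ := by rw [← Finset.sum_mul]; ring

end UStatistic

end RDPG

end

/-! ### Convergence of the scaled difference. -/

theorem mainTheorem3 {d m : ℕ} (F : Measure (EuclideanSpace ℝ (Fin d)))
    (hF : RDPG.IsInnerProductDistribution F)
    (hΔ : (RDPG.secondMoment F).rank = d)
    (h : (Fin m → EuclideanSpace ℝ (Fin d)) → ℝ)
    (h_symm : RDPG.IsSymmetricKernel h)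
    (h_inv : RDPG.IsOrthogonallyInvariant h)
    (h_smooth : RDPG.HasBoundedHessianNearSupport F h)
    {Ω : Type*} [MeasurableSpace Ω] (μ : Measure Ω) [IsProbabilityMeasure μ]
    (A : (n : ℕ) → Ω → Matrix (Fin n) (Fin n) ℝ)
    (X : (n : ℕ) → Ω → Fin n → EuclideanSpace ℝ (Fin d))
    (hAX : ∀ n, RDPG.IsRDPG μ F n (A n) (X n))
    (Xhat : (n : ℕ) → Ω → Fin n → EuclideanSpace ℝ (Fin d))
    (hXhat : ∀ n, d ≤ n → ∀ᵐ ω ∂μ, RDPG.IsASE (A n ω) (Xhat n ω)) :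
    ∀ᵐ ω ∂μ, Tendsto
      (fun n : ℕ => √(n : ℝ) * (RDPG.uStat h (Xhat n ω) - RDPG.uStat h (X n ω)))
      atTop (𝓝 0) := by
  obtain ⟨ε, hε, C₁, hC₁, C₂, hC₂, hT⟩ := h_smooth.exists_taylor_bound hF
  obtain ⟨K, hK, herr⟩ := RDPG.exists_ae_eventually_alignedError_le hF hΔ hAX hXhat
    (G := fun n x => RDPG.uStatGradient h x) (fun n i s => RDPG.measurable_uStatGradient h i s)
    (B := m * C₁)
    (.of_forall fun n x hx i s => RDPG.abs_uStatGradient_le hC₁ (fun z hz => (hT z hz).1) hx i s)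
  have hsupp : ∀ᵐ ω ∂μ, ∀ n, ∀ i, X n ω i ∈ F.support :=
    ae_all_iff.2 fun n => (hAX n).ae_mem_support hF
  have hlim : Tendsto (fun n => (K + C₂ * m * K) * RDPG.rate n) atTop (𝓝 0) := by
    simpa using RDPG.tendsto_rate.const_mul (K + C₂ * m * K)
  have hsmall : ∀ᶠ n in atTop, K * RDPG.rate n < ε := by
    have := RDPG.tendsto_rate.const_mul K
    rw [mul_zero] at this
    exact this.eventually_lt_const hε
  filter_upwards [herr, hsupp] with ω herr hsupp
  refine squeeze_zero_norm' ?_ hlim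
  filter_upwards [herr, hsmall, eventually_gt_atTop 0] with n herr hsmall hn
  obtain ⟨Q, hQ, hQ1, hQ2, hQ3⟩ := herr
  have hn' : (0 : ℝ) < n := by exact_mod_cast hn
  have hsn : 0 < √(n : ℝ) := Real.sqrt_pos.2 hn'
  have hsn2 : √(n : ℝ) * √n = n := Real.mul_self_sqrt hn'.le
  -- Invariance lets the rotation act on the embedding, so the gradient is taken at X itself and
  -- does not involve the edge-dependent Q.
  have hinv : RDPG.uStat h (Xhat n ω) =
      RDPG.uStat h fun i => Matrix.toEuclideanLin Q (Xhat n ω i) := by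
    unfold RDPG.uStat
    congr 1
    exact Finset.sum_congr rfl fun c _ => (h_inv Q hQ fun k => Xhat n ω (c k)).symm
  have hmain := RDPG.abs_uStat_sub_le (h := h) hε hC₂ (fun z hz => (hT z hz).2) hn (hsupp n)
    (y := fun i => Matrix.toEuclideanLin Q (Xhat n ω i)) fun i => (hQ1 i).trans_lt hsmall
  rw [Real.norm_eq_abs, abs_mul, abs_of_pos hsn, hinv]
  -- Both errors are K√n `rate n`; the outer √n and the factor 1/n cancel exactly, leaving a
  -- multiple of `rate n`.
  calc _ ≤ √(n : ℝ) * ((n : ℝ)⁻¹ * (K * (√n * RDPG.rate n)) +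
        C₂ * (m / n * (K * (√n * RDPG.rate n)))) := by
        refine mul_le_mul_of_nonneg_left (hmain.trans ?_) hsn.le
        refine add_le_add (mul_le_mul_of_nonneg_left hQ3 (by positivity)) ?_
        exact mul_le_mul_of_nonneg_left (mul_le_mul_of_nonneg_left hQ2 (by positivity)) hC₂
    _ = (√(n : ℝ) * √n) * ((n : ℝ)⁻¹ * K * RDPG.rate n + C₂ * (m / n) * K * RDPG.rate n) := by ring
    _ = (K + C₂ * m * K) * RDPG.rate n := by
        rw [hsn2]
        field_simp
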